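/- Let $n\ge 2$, let $N$ be a compact smooth $(n-1)$-dimensional manifold, with or without boundary, and let $k\in\mathbb R$. Put $\mathring h(r)=e^r+ke^{-r}$, let $a$ be the zero of $\mathring h$ if there is one and $a=-\infty$ if $\mathring h$ never vanishes, and let $M=(a,+\infty)\times N$. Let $\hat G$ be a smooth Riemannian metric on $N$, with Riemannian measure $\mu_{\hat G}$, and let $G(r)$, $r\in(a,+\infty)$, be a family of Riemannian metrics on $N$ such that $g=dr^2+G(r)$ is a smooth Riemannian metric on $M$. Let $g_0=dr^2+\mathring h^2(r)\hat G$. Denote by $R_{rr}$ and $\mathring R_{rr}$ the Ricci curvatures of $g$ and $g_0$ in the direction $(\partial_r,\partial_r)$, and by $H(r,x)$ and $\mathring H(r,x)$ the mean curvatures of the level set $\{r\}\times N$ at $(r,x)$ with respect to $g$ and $g_0$, that is, the traces of the Weingarten maps $X\mapsto\nabla_X\partial_r$. Let $$m(r,x)=\mathring h^2(r)\,\bigl(\mathring H(r,x)-H(r,x)\bigr),\qquad \mathcal M(r)=\int_N m(r,x)\,d\mu_{\hat G}(x).$$ Then $\mathring R_{rr}=-(n-1)$ on $M$. Assume that the (finite)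 limits $\mathcal M(a)=\lim_{r\to a^+}\mathcal M(r)$ and $\mathcal M(+\infty)=\lim_{r\to+\infty}\mathcal M(r)$ exist and that $\mathring h^2\,(R_{rr}+(n-1))\in L^1(M,dr\,d\mu_{\hat G})$. Then $$\mathcal M(+\infty)-\mathcal M(a)\ \ge\ \int_M\mathring h^2\,\bigl(R_{rr}+(n-1)\bigr)\,dr\,d\mu_{\hat G},$$ with equality if and only if $g$ is a warped product, i.e. there is a Riemannian metric $\widetilde G$ on $N$ such that $G(r)=\mathring h^2(r)\,\widetilde G$ for all $r\in(a,+\infty)$. Moreover, if for some $r_0\in[a,+\infty]$ the metric $g$ is asymptotic to $g_0$ at $r_0$, i.e. $\|G(r)-\mathring h^2(r)\hat G\|_{\mathring h^2(r)\hat G}\to 0$ uniformly on $N$ as $r\to r_0$ in $(a,+\infty)$ (if $r_0\in(a,+\infty)$, this includes $r=r_0$ and means that $G(r_0)=\mathring h^2(r_0)\hat G$), then equality holds if and only if $g=g_0$ on $M$. -/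

import Mathlib

open Set Filter MeasureTheory Bundle
open scoped Manifold ContDiff Topology

namespace RadialMass

noncomputable section

/-- The parameters `r` of the open interval `(a, +∞)`, where `a` may be `-∞`. -/
def radii (a : EReal) : Set ℝ := {r : ℝ | a < (r : EReal)}

/-- The filter "`r → r₀` with `r ∈ (a, +∞)`", for a point `r₀` of `[a, +∞]`. -/
def toward (a r₀ : EReal) : Filter ℝ := comap Real.toEReal (𝓝[Ioi a] r₀)

/-- The warping function `e^r + k e^{-r}`. -/
def warp (k r : ℝ) : ℝ := Real.exp r + k * Real.exp (-r)

variable {d : ℕ} {H : Type*} [TopologicalSpace H]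
  (I : ModelWithCorners ℝ (EuclideanSpace ℝ (Fin d)) H)
  {N : Type*} [TopologicalSpace N] [ChartedSpace H N]

/-- Riemannian metrics of class `C^∞` on `N` (with boundary if the model `I` has one). -/
abbrev SmoothMetric [IsManifold I ∞ N] : Type _ :=
  ContMDiffRiemannianMetric I ∞ (EuclideanSpace ℝ (Fin d)) (fun x : N => TangentSpace I x)

/-- Fields of bilinear forms on the tangent spaces of `N`. -/
abbrev BilinField (N : Type*) [TopologicalSpace N] [ChartedSpace H N] : Type _ :=
  (x : N) → TangentSpace I x →L[ℝ] TangentSpace I x →L[ℝ] ℝ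

/-- The family `r ↦ G(r)` of metrics on `N` is smooth in `(r, x) ∈ (a, +∞) × N`
(that is, `dr² + G(r)` is a smooth metric on `(a, +∞) × N`). -/
def SmoothFamily [IsManifold I ∞ N] (a : EReal) (G : ℝ → SmoothMetric I (N := N)) : Prop :=
  ContMDiffOn (𝓘(ℝ, ℝ).prod I)
    (I.prod 𝓘(ℝ, EuclideanSpace ℝ (Fin d) →L[ℝ] EuclideanSpace ℝ (Fin d) →L[ℝ] ℝ)) ∞
    (fun p : ℝ × N =>
      (TotalSpace.mk' (EuclideanSpace ℝ (Fin d) →L[ℝ] EuclideanSpace ℝ (Fin d) →L[ℝ] ℝ)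
        (E := fun x : N => TangentSpace I x →L[ℝ] TangentSpace I x →L[ℝ] ℝ)
        p.2 ((G p.1).inner p.2)))
    (radii a ×ˢ univ)

/-- The coordinate vector field `∂/∂x^A` of the chart at `x`, at the point of `N` with
coordinates `y`. -/
def coordField (x : N) (y : EuclideanSpace ℝ (Fin d)) (A : Fin d) :
    TangentSpace I ((extChartAt I x).symm y) :=
  mfderivWithin 𝓘(ℝ, EuclideanSpace ℝ (Fin d)) I (extChartAt I x).symm (range I) y
    (EuclideanSpace.single A (1 : ℝ))

/-- The matrix of components `b_{AB}(y) = b(∂_A, ∂_B)` in the chart at `x`. -/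
def gram (b : BilinField I N) (x : N) (y : EuclideanSpace ℝ (Fin d)) :
    Matrix (Fin d) (Fin d) ℝ :=
  Matrix.of fun A B =>
    b ((extChartAt I x).symm y) (coordField I x y A) (coordField I x y B)

/-! ### The Riemannian measure of a metric on `N` -/

section Volume

variable [MeasurableSpace N]

/-- The measure `√(det b_{AB}) dx^1 ⋯ dx^d` on the domain of the chart at `x`, extended by zero
to `N`. -/
def chartVolume (b : BilinField I N) (x : N) : Measure N :=
  ((volume.restrict (extChartAt I x).target).withDensity
    (fun y => ENNReal.ofReal (Real.sqrt (gram I b x y).det))).map (extChartAt I x).symm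

/-- The Riemannian measure of `b`: the smallest measure that dominates `√(det b_{AB}) dx` in every
chart. As these chart measures agree on overlaps, it is the measure that restricts to
`√(det b_{AB}) dx` on the domain of each chart. -/
def riemVolume (b : BilinField I N) : Measure N := ⨆ x : N, chartVolume I b x

end Volume

/-! ### The metric `dr² + G(r)` in adapted coordinates `(x^0, x^A) = (r, x^A)`

The index `Sum.inl ()` stands for `r`, and `Sum.inr A` for `x^A`. -/

/-- The indices of the adapted coordinates. -/
abbrev Idx (d : ℕ) : Type := Unit ⊕ Fin d

/-- The index of the coordinate `r`. -/
abbrev rIdx (d : ℕ) : Idx d := Sum.inl ()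

/-- The vector `e_i` of the coordinate space `ℝ × ℝ^d`. -/
def basisVec : Idx d → ℝ × EuclideanSpace ℝ (Fin d)
  | Sum.inl _ => (1, 0)
  | Sum.inr A => (0, EuclideanSpace.single A (1 : ℝ))

/-- The partial derivative `∂_i f` of a function of `(r, x^A)`; it is taken within the range of
the coordinates, so that it is one-sided at boundary points of `N`. -/
def pd (f : ℝ × EuclideanSpace ℝ (Fin d) → ℝ) (i : Idx d)
    (p : ℝ × EuclideanSpace ℝ (Fin d)) : ℝ :=
  fderivWithin ℝ f (univ ×ˢ range I) p (basisVec i)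

/-- The components `g_{ij}(r, y)` of `g = dr² + G_{AB} dx^A dx^B` in the chart at `x`. -/
def metricComp (G : ℝ → BilinField I N) (x : N) (p : ℝ × EuclideanSpace ℝ (Fin d)) :
    Matrix (Idx d) (Idx d) ℝ :=
  Matrix.fromBlocks 1 0 0 (gram I (G p.1) x p.2)

/-- The Christoffel symbol
`Γ^i_{jk} = ½ g^{il} (∂_j g_{lk} + ∂_k g_{lj} - ∂_l g_{jk})` of `g = dr² + G(r)`. -/
def christoffel (G : ℝ → BilinField I N) (x : N) (i j k : Idx d)
    (p : ℝ × EuclideanSpace ℝ (Fin d)) : ℝ :=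
  (1 / 2) * ∑ l, (metricComp I G x p)⁻¹ i l *
    (pd I (fun q => metricComp I G x q l k) j p + pd I (fun q => metricComp I G x q l j) k p
      - pd I (fun q => metricComp I G x q j k) l p)

/-- The component
`R_{jk} = ∂_i Γ^i_{jk} - ∂_j Γ^i_{ik} + Γ^i_{il} Γ^l_{jk} - Γ^i_{jl} Γ^l_{ik}` of the Ricci
curvature of `g = dr² + G(r)`. -/
def ricciComp (G : ℝ → BilinField I N) (x : N) (j k : Idx d)
    (p : ℝ × EuclideanSpace ℝ (Fin d)) : ℝ :=
  (∑ i, pd I (christoffel I G x i j k) i p) - (∑ i, pd I (christoffel I G x i i k) j p)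
    + (∑ i, ∑ l, christoffel I G x i i l p * christoffel I G x l j k p)
    - ∑ i, ∑ l, christoffel I G x i j l p * christoffel I G x l i k p

/-- The Ricci curvature `R_rr(r, x)` of `g = dr² + G(r)` in the direction `(∂_r, ∂_r)`. -/
def ricciRR (G : ℝ → BilinField I N) (r : ℝ) (x : N) : ℝ :=
  ricciComp I G x (rIdx d) (rIdx d) (r, extChartAt I x x)

/-- The Weingarten map `S : X ↦ ∇_X ∂_r` of the level set `{r} × N` at `(r, x)`, for the metric
`dr² + G(r)` and the normal `∂_r`: its entries are `S^B_A = Γ^B_{Ar}`. -/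
def weingarten (G : ℝ → BilinField I N) (r : ℝ) (x : N) : Matrix (Fin d) (Fin d) ℝ :=
  Matrix.of fun B A =>
    christoffel I G x (Sum.inr B) (Sum.inr A) (rIdx d) (r, extChartAt I x x)

/-- The mean curvature `H = Tr S` of the level set `{r} × N` at `(r, x)`. -/
def meanCurv (G : ℝ → BilinField I N) (r : ℝ) (x : N) : ℝ := (weingarten I G r x).trace

/-! ### The background metric and the radial mass -/

/-- The family `r ↦ h(r)² b`. -/
def warpFamily (h : ℝ → ℝ) (b : BilinField I N) : ℝ → BilinField I N :=
  fun r x => h r ^ 2 • b x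

/-- The radial mass `m(r, x) = h² (H₀ - H)` of `dr² + G(r)` relative to `dr² + h² Ĝ`. -/
def localMass (h : ℝ → ℝ) (Ghat : BilinField I N) (G : ℝ → BilinField I N) (r : ℝ) (x : N) : ℝ :=
  h r ^ 2 * (meanCurv I (warpFamily I h Ghat) r x - meanCurv I G r x)

/-- The radial mass `𝓜(r) = ∫_N m(r, x) dμ_Ĝ(x)`. -/
def mass [MeasurableSpace N] (h : ℝ → ℝ) (Ghat : BilinField I N) (G : ℝ → BilinField I N)
    (r : ℝ) : ℝ :=
  ∫ x, localMass I h Ghat G r x ∂(riemVolume I Ghat)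

/-- `‖G(r) - h² Ĝ‖ = o(1)` uniformly on `N` as `r → r₀` in `(a, +∞)`, where the norm is the
operator norm of bilinear forms with respect to `h² Ĝ`. -/
def AsymptoticAt (a : EReal) (h : ℝ → ℝ) (Ghat : BilinField I N) (G : ℝ → BilinField I N)
    (r₀ : EReal) : Prop :=
  ∀ ε : ℝ, 0 < ε → ∀ᶠ r in toward a r₀, ∀ (x : N) (v w : TangentSpace I x),
    |G r x v w - warpFamily I h Ghat r x v w| ≤
      ε * (Real.sqrt (warpFamily I h Ghat r x v v) * Real.sqrt (warpFamily I h Ghat r x w w))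

end

end RadialMass

/-! Write `h` for the warping function, `d = n - 1`, and `S` for the Weingarten map of the level
sets. In adapted coordinates `S = ½ G⁻¹ ∂_r G`, and the traced Riccati equation reads `∂_r H = -R_rr
- tr S²`. The background has `S = h'/h`, so the local mass is `m = d h h' - h² H`. As `h'' = h`,
differentiating gives `∂_r m = h² (R_rr + d) + tr ((h' - h S)²)`. Since `S` is self-adjoint for
`G(r)`, the last term (`excess`) is nonnegative, and it vanishes only where `S = h'/h`.

Integrating over compact strips `(u, v] × N` and exhausting `(a, +∞) × N` yields the inequality
(`mass_increment`). Equality makes the integral of the excess vanish; the excess is continuous and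
the Riemannian measure charges open sets, so the excess is identically zero. This means `∂_r G = 2
(h'/h) G`, i.e. `h⁻² G` does not depend on `r` (`eq_smul_of_excess_eq_zero`). For such a warped
product the norm of `G - h² Ĝ` relative to `h² Ĝ` does not depend on `r` either, so it can tend to
zero only if it is zero (`eq_of_asymptoticAt`).

The computation rests on `ricciRR_eq`, `hasDerivAt_localMass` and `excess_nonneg`. The rest is
global: the traces involved do not depend on the chart (`traces_change`), and the Riemannian measure
is finite and positive on open sets. -/

namespace RadialMass

/-! ### Traces of squares of self-adjoint endomorphisms. -/

section MatrixAlgebra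

variable {m : Type*} [Fintype m] [DecidableEq m]

open scoped MatrixOrder in
/-- A positive definite real matrix is the square of an invertible symmetric matrix. -/
lemma exists_symm_sqrt {A : Matrix m m ℝ} (hA : A.PosDef) :
    ∃ X : Matrix m m ℝ, IsUnit X ∧ X.IsSymm ∧ X * X = A := by
  obtain ⟨X, hX, -, hXA⟩ := CFC.exists_sqrt_of_isSelfAdjoint_of_quasispectrumRestricts
    (a := A) hA.isHermitian (QuasispectrumRestricts.nnreal_of_nonneg hA.posSemidef.nonneg)
  refine ⟨X, ?_, ?_, hXA⟩
  · have := hA.isUnit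
    rw [← hXA] at this
    exact isUnit_of_mul_isUnit_left this
  · have := hX.star_eq
    rwa [Matrix.star_eq_conjTranspose, Matrix.conjTranspose_eq_transpose_of_trivial] at this

/-- With `A⁻¹ = X²`, `X` symmetric, cyclicity of the trace replaces `A⁻¹ B` by the symmetric matrix
`X B X`, and the trace of its square is a sum of squares of entries. -/
lemma trace_sq_inv_mul {A B : Matrix m m ℝ} (hA : A.PosDef) (hB : B.IsSymm) :
    0 ≤ ((A⁻¹ * B) * (A⁻¹ * B)).trace ∧ (((A⁻¹ * B) * (A⁻¹ * B)).trace = 0 ↔ B = 0) := by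
  obtain ⟨X, hXu, hXs, hXA⟩ := exists_symm_sqrt hA.inv
  set C := X * B * X with hC
  have hCs : C.transpose = C := by
    simp [hC, Matrix.transpose_mul, hXs.eq, hB.eq, Matrix.mul_assoc]
  have htr : ((A⁻¹ * B) * (A⁻¹ * B)).trace = (C.transpose * C).trace := by
    rw [hCs, hC, ← hXA]
    simp only [Matrix.mul_assoc]
    rw [Matrix.trace_mul_comm X]
    simp only [Matrix.mul_assoc]
  have hps : (C.transpose * C).PosSemidef := by
    simpa using Matrix.posSemidef_conjTranspose_mul_self C
  rw [htr]
  refine ⟨hps.trace_nonneg, ?_⟩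
  have h0 : (C.transpose * C).trace = 0 ↔ C = 0 := by
    simpa using Matrix.trace_conjTranspose_mul_self_eq_zero_iff (A := C)
  rw [h0, hC]
  constructor
  · intro h
    have h1 : X * B = 0 := hXu.mul_left_eq_zero.1 h
    exact hXu.mul_right_eq_zero.1 h1
  · rintro rfl; simp

/-- The trace of the square of `c - s A⁻¹ B`. -/
lemma trace_sq_smul_one_sub {A B : Matrix m m ℝ} (hA : A.PosDef) (hB : B.IsSymm) (c s : ℝ)
    (hs : s ≠ 0) :
    let T := Fintype.card m * c ^ 2 - 2 * c * s * (A⁻¹ * B).trace +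
      s ^ 2 * ((A⁻¹ * B) * (A⁻¹ * B)).trace
    0 ≤ T ∧ (T = 0 ↔ B = (c / s) • A) := by
  intro T
  have hAu : IsUnit A.det := (Matrix.isUnit_iff_isUnit_det _).1 hA.isUnit
  have hAs : A.IsSymm := by
    have := hA.isHermitian
    rwa [Matrix.isHermitian_iff_isSymm] at this
  have hD : (c • A - s • B).IsSymm := (hAs.smul c).sub (hB.smul s)
  have key := trace_sq_inv_mul hA hD
  have hT : ((A⁻¹ * (c • A - s • B)) * (A⁻¹ * (c • A - s • B))).trace = T := by
    have : A⁻¹ * (c • A - s • B) = c • (1 : Matrix m m ℝ) - s • (A⁻¹ * B) := by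
      rw [Matrix.mul_sub, Matrix.mul_smul, Matrix.mul_smul, Matrix.nonsing_inv_mul _ hAu]
    rw [this]
    simp only [Matrix.mul_sub, Matrix.sub_mul, Matrix.smul_mul, Matrix.mul_smul, Matrix.one_mul,
      Matrix.mul_one, Matrix.trace_sub, Matrix.trace_smul, Matrix.trace_one, smul_eq_mul, T]
    ring
  rw [hT] at key
  refine ⟨key.1, key.2.trans ?_⟩
  rw [sub_eq_zero]
  constructor
  · intro h
    rw [div_eq_inv_mul, mul_smul, h, smul_smul, inv_mul_cancel₀ hs, one_smul]
  · rintro rfl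
    rw [smul_smul, mul_div_cancel₀ _ hs]

/-- Congruent pairs of matrices have similar quotients. -/
lemma inv_mul_congr {A B P : Matrix m m ℝ} (hP : IsUnit P.det) :
    (P.transpose * A * P)⁻¹ * (P.transpose * B * P) = P⁻¹ * (A⁻¹ * B) * P := by
  have hPt : IsUnit P.transpose.det := by rwa [Matrix.det_transpose]
  rw [Matrix.mul_inv_rev, Matrix.mul_inv_rev]
  simp only [Matrix.mul_assoc]
  rw [Matrix.nonsing_inv_mul_cancel_left _ _ hPt]

lemma trace_conj_inv {X P : Matrix m m ℝ} (hP : IsUnit P.det) :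
    (P⁻¹ * X * P).trace = X.trace := by
  rw [Matrix.trace_mul_comm, ← Matrix.mul_assoc, Matrix.mul_nonsing_inv _ hP, Matrix.one_mul]

lemma trace_conj_inv_sq {X P : Matrix m m ℝ} (hP : IsUnit P.det) :
    ((P⁻¹ * X * P) * (P⁻¹ * X * P)).trace = (X * X).trace := by
  have : (P⁻¹ * X * P) * (P⁻¹ * X * P) = P⁻¹ * (X * X) * P := by
    simp only [Matrix.mul_assoc]
    rw [Matrix.mul_nonsing_inv_cancel_left _ _ hP]
  rw [this, trace_conj_inv hP]

end MatrixAlgebra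

/-! ### Differentiation of curves of matrices. -/

section MatrixCurves

variable {m : Type*} [Fintype m] [DecidableEq m]

attribute [local instance] Matrix.linftyOpNormedRing Matrix.linftyOpNormedAlgebra in
/-- The derivative of the inverse of a curve of invertible matrices. -/
lemma hasDerivAt_inv_entry {A : ℝ → Matrix m m ℝ} {A' : Matrix m m ℝ} {r : ℝ}
    (h : ∀ i j, HasDerivAt (fun s => A s i j) (A' i j) r) (hA : IsUnit (A r)) (i j : m) :
    HasDerivAt (fun s => (A s)⁻¹ i j) ((-((A r)⁻¹ * A' * (A r)⁻¹)) i j) r := by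
  -- Expanding in matrix units turns the entrywise derivatives into a derivative in a normed
  -- algebra, where inversion is differentiable; the choice of norm is immaterial.
  have h1 : HasDerivAt A A' r := by
    have : HasDerivAt (fun s => ∑ i, ∑ j, A s i j • Matrix.single i j (1 : ℝ))
        (∑ i, ∑ j, A' i j • Matrix.single i j (1 : ℝ)) r :=
      HasDerivAt.fun_sum fun i _ => HasDerivAt.fun_sum fun j _ => (h i j).smul_const _
    have e (M : Matrix m m ℝ) : M = ∑ i, ∑ j, M i j • Matrix.single i j (1 : ℝ) := by
      conv_lhs => rw [Matrix.matrix_eq_sum_single M]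
      simp
    rw [← e] at this
    exact this.congr_of_eventuallyEq (Eventually.of_forall fun s => e (A s))
  obtain ⟨u, hu⟩ := hA
  have h2 := hasFDerivAt_ringInverse (𝕜 := ℝ) u
  rw [hu] at h2
  have h3 := h2.comp_hasDerivAt r h1
  let L : Matrix m m ℝ →L[ℝ] ℝ := LinearMap.toContinuousLinearMap (Matrix.entryLinearMap ℝ ℝ i j)
  have h4 := L.hasFDerivAt.comp_hasDerivAt r h3
  have e2 : ((u⁻¹ : (Matrix m m ℝ)ˣ) : Matrix m m ℝ) = (A r)⁻¹ := by
    rw [← hu]; simp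
  rw [e2] at h4
  have e3 : (L ∘ Ring.inverse ∘ A) = fun s => (A s)⁻¹ i j := by
    funext s
    simp [L, Matrix.nonsing_inv_eq_ringInverse]
  rw [e3] at h4
  exact h4

/-- The derivative of `tr (A⁻¹ B)`. -/
lemma hasDerivAt_trace_inv_mul {A B : ℝ → Matrix m m ℝ} {A' B' : Matrix m m ℝ} {r : ℝ}
    (hA : ∀ i j, HasDerivAt (fun s => A s i j) (A' i j) r)
    (hB : ∀ i j, HasDerivAt (fun s => B s i j) (B' i j) r) (hu : IsUnit (A r)) :
    HasDerivAt (fun s => ((A s)⁻¹ * B s).trace)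
      (((A r)⁻¹ * B').trace - (((A r)⁻¹ * A') * ((A r)⁻¹ * B r)).trace) r := by
  have : HasDerivAt (fun s => ∑ i, ∑ j, (A s)⁻¹ i j * B s j i)
      (∑ i, ∑ j, ((-((A r)⁻¹ * A' * (A r)⁻¹)) i j * B r j i + (A r)⁻¹ i j * B' j i)) r :=
    HasDerivAt.fun_sum fun i _ => HasDerivAt.fun_sum fun j _ =>
      (hasDerivAt_inv_entry hA hu i j).mul (hB j i)
  have e : ∀ X Y : Matrix m m ℝ, (X * Y).trace = ∑ i, ∑ j, X i j * Y j i := fun X Y => by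
    simp [Matrix.trace, Matrix.mul_apply]
  simp only [← Matrix.mul_assoc, e]
  refine this.congr_deriv ?_
  simp only [Finset.sum_add_distrib, Matrix.neg_apply, neg_mul, Finset.sum_neg_distrib]
  ring

end MatrixCurves

/-! ### Coordinate frames and the transformation law of components. -/

section Frames

variable {d : ℕ} {H : Type*} [TopologicalSpace H]
  {I : ModelWithCorners ℝ (EuclideanSpace ℝ (Fin d)) H}
  {N : Type*} [TopologicalSpace N] [ChartedSpace H N] [IsManifold I ∞ N]

local notation "𝔼" => EuclideanSpace ℝ (Fin d)

variable (I) in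
/-- The coordinate frame of the chart at `x`, at the point `z`. -/
noncomputable def frame (x z : N) (A : Fin d) : TangentSpace I z :=
  (trivializationAt 𝔼 (TangentSpace I : N → Type _) x).symmL ℝ z (EuclideanSpace.single A (1 : ℝ))

/-- Ties the coordinate fields to the trivializations of the tangent bundle, through which
smoothness and changes of chart are accessible. -/
lemma coordField_eq_frame {x : N} {y : 𝔼} (hy : y ∈ (extChartAt I x).target) (A : Fin d) :
    coordField I x y A = frame I x ((extChartAt I x).symm y) A := by
  have hs : (extChartAt I x).symm y ∈ (chartAt H x).source := by
    rw [← extChartAt_source I]; exact (extChartAt I x).map_target hy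
  have h := TangentBundle.symmL_trivializationAt (I := I) (𝕜 := ℝ) hs
  unfold frame
  rw [h]
  -- Every tangent space is the model space, so the two sides are values of one map into `𝔼` at `y`
  -- and at its image under the round trip through the chart.
  let Φ : 𝔼 → 𝔼 := fun y' =>
    (mfderivWithin 𝓘(ℝ, 𝔼) I (extChartAt I x).symm (range I) y' : 𝔼 → 𝔼)
      (EuclideanSpace.single A (1 : ℝ))
  exact congrArg Φ ((extChartAt I x).right_inv hy).symm

lemma gram_symm_apply (b : BilinField I N) {x : N} {y : 𝔼} (hy : y ∈ (extChartAt I x).target)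
    (A B : Fin d) :
    gram I b x y A B = b ((extChartAt I x).symm y) (frame I x _ A) (frame I x _ B) := by
  simp only [gram, Matrix.of_apply, coordField_eq_frame hy]

lemma gram_apply (b : BilinField I N) {x z : N} (hz : z ∈ (extChartAt I x).source) (A B : Fin d) :
    gram I b x (extChartAt I x z) A B = b z (frame I x z A) (frame I x z B) := by
  rw [gram_symm_apply b ((extChartAt I x).map_source hz)]
  let F : N → ℝ := fun z => b z (frame I x z A) (frame I x z B)
  exact congrArg F ((extChartAt I x).left_inv hz)

lemma frame_eq_tangentCoordChange {x z : N} (hz : z ∈ (extChartAt I x).source) (A : Fin d) :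
    frame I x z A = (tangentCoordChange I x z z (EuclideanSpace.single A (1 : ℝ) : 𝔼) : 𝔼) := by
  have hs : z ∈ (chartAt H x).source := by rwa [← extChartAt_source I]
  unfold frame
  rw [TangentBundle.symmL_trivializationAt_eq_core hs]
  rfl

/-- The tangent space at `z` is identified with `𝔼` by the preferred chart at `z`, whose frame is
therefore the standard basis. Tensors at `z` can thus be read off from their components in that
chart. -/
lemma frame_self (z : N) (A : Fin d) :
    frame I z z A = (EuclideanSpace.single A (1 : ℝ) : 𝔼) := by
  rw [frame_eq_tangentCoordChange (mem_extChartAt_source z)]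
  have h := tangentCoordChange_self (I := I) (v := (EuclideanSpace.single A (1 : ℝ) : 𝔼))
    (mem_extChartAt_source z)
  exact h

variable (I) in
/-- The Jacobian matrix at `z` of the change of coordinates from the chart at `x` to that at `x'`. -/
noncomputable def jacobian (x x' z : N) : Matrix (Fin d) (Fin d) ℝ :=
  LinearMap.toMatrix (EuclideanSpace.basisFun (Fin d) ℝ).toBasis
    (EuclideanSpace.basisFun (Fin d) ℝ).toBasis (tangentCoordChange I x x' z : 𝔼 →ₗ[ℝ] 𝔼)

lemma det_jacobian (x x' z : N) : (jacobian I x x' z).det = (tangentCoordChange I x x' z).det := by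
  rw [jacobian, LinearMap.det_toMatrix]

lemma isUnit_det_jacobian {x x' z : N} (hz : z ∈ (extChartAt I x).source)
    (hz' : z ∈ (extChartAt I x').source) : IsUnit (jacobian I x x' z).det := by
  have h : (tangentCoordChange I x' x z : 𝔼 →ₗ[ℝ] 𝔼) ∘ₗ (tangentCoordChange I x x' z : 𝔼 →ₗ[ℝ] 𝔼)
      = LinearMap.id := by
    ext1 v
    change tangentCoordChange I x' x z (tangentCoordChange I x x' z v) = v
    rw [tangentCoordChange_comp ⟨⟨hz, hz'⟩, hz⟩, tangentCoordChange_self hz]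
  have h2 : jacobian I x' x z * jacobian I x x' z = 1 := by
    rw [jacobian, jacobian, ← LinearMap.toMatrix_comp, h, LinearMap.toMatrix_id]
  exact Matrix.isUnit_det_of_left_inverse h2

lemma frame_change {x x' z : N} (hz : z ∈ (extChartAt I x).source)
    (hz' : z ∈ (extChartAt I x').source) (A : Fin d) :
    frame I x z A = ∑ C, jacobian I x x' z C A • frame I x' z C := by
  have hz0 := mem_extChartAt_source (I := I) z
  rw [frame_eq_tangentCoordChange hz, ← tangentCoordChange_comp ⟨⟨hz, hz'⟩, hz0⟩]
  set v := tangentCoordChange I x x' z (EuclideanSpace.single A (1 : ℝ)) with hv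
  have hP (C : Fin d) : jacobian I x x' z C A = v C := by
    simp [jacobian, LinearMap.toMatrix_apply, hv]
  have hsum : v = ∑ C, v C • (EuclideanSpace.single C (1 : ℝ) : 𝔼) := by
    have := (EuclideanSpace.basisFun (Fin d) ℝ).sum_repr v
    simpa using this.symm
  conv_lhs => rw [hsum, map_sum]
  refine Finset.sum_congr rfl fun C _ => ?_
  rw [map_smul, frame_eq_tangentCoordChange hz', hP]
  rfl

/-- The law of transformation of the components of a bilinear form. -/
lemma gram_change (b : BilinField I N) {x x' z : N} (hz : z ∈ (extChartAt I x).source)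
    (hz' : z ∈ (extChartAt I x').source) :
    gram I b x (extChartAt I x z) =
      (jacobian I x x' z).transpose * gram I b x' (extChartAt I x' z) * jacobian I x x' z := by
  ext A B
  rw [gram_apply b hz, frame_change hz hz' A, frame_change hz hz' B]
  simp only [map_sum, map_smul, sum_apply, smul_apply,
    Matrix.mul_apply, Matrix.transpose_apply, gram_apply b hz', smul_eq_mul, Finset.sum_mul]
  simp only [Finset.mul_sum]
  refine Finset.sum_congr rfl fun C _ => Finset.sum_congr rfl fun D _ => ?_
  ring

lemma gram_self_apply (b : BilinField I N) (z : N) (A B : Fin d) :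
    gram I b z (extChartAt I z z) A B =
      b z (EuclideanSpace.single A (1 : ℝ) : 𝔼) (EuclideanSpace.single B (1 : ℝ) : 𝔼) := by
  rw [gram_apply b (mem_extChartAt_source z), frame_self, frame_self]

/-- A bilinear form is determined by its components. -/
lemma bilin_eq_sum_gram (b : BilinField I N) (z : N) (v w : 𝔼) :
    b z v w = ∑ A, ∑ B, v A * w B * gram I b z (extChartAt I z z) A B := by
  have hsum (v : 𝔼) : v = ∑ C, v C • (EuclideanSpace.single C (1 : ℝ) : 𝔼) := by
    have := (EuclideanSpace.basisFun (Fin d) ℝ).sum_repr v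
    simpa using this.symm
  let β : 𝔼 →L[ℝ] 𝔼 →L[ℝ] ℝ := b z
  change β v w = _
  have hg (A B : Fin d) : gram I b z (extChartAt I z z) A B =
    β (EuclideanSpace.single A (1 : ℝ)) (EuclideanSpace.single B (1 : ℝ)) := gram_self_apply b z A B
  conv_lhs => rw [hsum v, hsum w]
  simp only [map_sum, map_smul, sum_apply, smul_apply,
    smul_eq_mul, hg, Finset.mul_sum]
  rw [Finset.sum_comm]
  refine Finset.sum_congr rfl fun C _ => Finset.sum_congr rfl fun D _ => ?_
  ring

/-- Clear in the chart centred at `z`, where the frame is the standard basis; any other chart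
changes the matrix by an invertible congruence. -/
lemma gram_posDef (b : BilinField I N) {x z : N} (hz : z ∈ (extChartAt I x).source)
    (hsymm : ∀ v w, b z v w = b z w v) (hpos : ∀ v, v ≠ 0 → 0 < b z v v) :
    (gram I b x (extChartAt I x z)).PosDef := by
  have h0 : (gram I b z (extChartAt I z z)).PosDef := by
    refine Matrix.PosDef.of_dotProduct_mulVec_pos ?_ fun v hv => ?_
    · ext A B
      rw [Matrix.conjTranspose_apply, star_trivial, gram_self_apply, gram_self_apply]
      exact hsymm _ _
    · let V : 𝔼 := WithLp.toLp 2 v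
      have hV : V ≠ 0 := fun h => hv (by
        have := congrArg WithLp.ofLp h
        simpa [V] using this)
      have := hpos V hV
      rw [bilin_eq_sum_gram] at this
      refine this.trans_eq ?_
      simp only [dotProduct, Matrix.mulVec, Finset.mul_sum, star_trivial, V]
      refine Finset.sum_congr rfl fun C _ => Finset.sum_congr rfl fun D _ => ?_
      ring
  rw [gram_change b hz (mem_extChartAt_source z)]
  have hu := isUnit_det_jacobian hz (mem_extChartAt_source (I := I) z)
  have := h0.conjTranspose_mul_mul_same (B := jacobian I x z z)
    (Matrix.mulVec_injective_iff_isUnit.2 ((Matrix.isUnit_iff_isUnit_det _).2 hu))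
  simpa using this

lemma contMDiffAt_frame (x : N) {z : N} (hz : z ∈ (extChartAt I x).source) (A : Fin d) :
    ContMDiffAt I (I.prod 𝓘(ℝ, 𝔼)) ∞
      (fun z => TotalSpace.mk' 𝔼 (E := (TangentSpace I : N → Type _)) z (frame I x z A)) z := by
  have hz' : z ∈ (trivializationAt 𝔼 (TangentSpace I : N → Type _) x).baseSet := by
    rw [TangentBundle.trivializationAt_baseSet]; rwa [← extChartAt_source I]
  have h1 := Bundle.Trivialization.contMDiffAt_symmL (𝕜 := ℝ) (n := ∞) (IB := I)
    (trivializationAt 𝔼 (TangentSpace I : N → Type _) x) hz'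
  have h2 : ContMDiffAt I (I.prod 𝓘(ℝ, 𝔼)) ∞
      (fun z => TotalSpace.mk' 𝔼 (E := Bundle.Trivial N 𝔼) z
        (EuclideanSpace.single A (1 : ℝ) : 𝔼)) z := by
    rw [contMDiffAt_totalSpace]
    exact ⟨contMDiffAt_id, contMDiffAt_const⟩
  exact ContMDiffAt.clm_bundle_apply (F₁ := 𝔼) (E₁ := Bundle.Trivial N 𝔼) h1 h2

end Frames

/-! ### Smooth families of metrics: `G(r)`, the constant family, and `h² Ĝ`. -/

section Families

variable {d : ℕ} {H : Type*} [TopologicalSpace H]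
  {I : ModelWithCorners ℝ (EuclideanSpace ℝ (Fin d)) H}
  {N : Type*} [TopologicalSpace N] [ChartedSpace H N]

local notation "𝔼" => EuclideanSpace ℝ (Fin d)

/-- A family of Riemannian metrics with parameter in `R`, with components smooth in the parameter
and the coordinates. -/
structure IsMetricFamily (R : Set ℝ) (b : ℝ → BilinField I N) : Prop where
  isOpen : IsOpen R
  smooth : ∀ x A B, ContDiffOn ℝ ∞ (fun p : ℝ × 𝔼 => gram I (b p.1) x p.2 A B)
    (R ×ˢ (extChartAt I x).target)
  symm : ∀ r ∈ R, ∀ x v w, b r x v w = b r x w v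
  pos : ∀ r ∈ R, ∀ x v, v ≠ 0 → 0 < b r x v v

lemma warpFamily_apply (h : ℝ → ℝ) (b : BilinField I N) (r : ℝ) (x : N) (v w : TangentSpace I x) :
    warpFamily I h b r x v w = h r ^ 2 * b x v w := rfl

lemma gram_warpFamily (h : ℝ → ℝ) (b : BilinField I N) (r : ℝ) (x : N) (y : 𝔼) :
    gram I (warpFamily I h b r) x y = h r ^ 2 • gram I b x y := by
  ext A B
  rfl

variable [IsManifold I ∞ N]

/-- The components are the family, pulled back by `(r, y) ↦ (r, φ⁻¹ y)` for the chart `φ`, evaluated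
on two smooth frame fields. -/
lemma contDiffOn_gram {R : Set ℝ} {b : ℝ → BilinField I N}
    (hb : ContMDiffOn (𝓘(ℝ, ℝ).prod I) (I.prod 𝓘(ℝ, 𝔼 →L[ℝ] 𝔼 →L[ℝ] ℝ)) ∞
      (fun p : ℝ × N => (TotalSpace.mk' (𝔼 →L[ℝ] 𝔼 →L[ℝ] ℝ)
        (E := fun x : N => TangentSpace I x →L[ℝ] TangentSpace I x →L[ℝ] ℝ)
        p.2 (b p.1 p.2))) (R ×ˢ univ)) (x : N) (A B : Fin d) :
    ContDiffOn ℝ ∞ (fun p : ℝ × 𝔼 => gram I (b p.1) x p.2 A B)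
      (R ×ˢ (extChartAt I x).target) := by
  set S := R ×ˢ (extChartAt I x).target
  have h1 : ContDiffOn ℝ ∞ (fun p : ℝ × 𝔼 => b p.1 ((extChartAt I x).symm p.2)
      (frame I x _ A) (frame I x _ B)) S := by
    rw [← contMDiffOn_iff_contDiffOn]
    intro p hp
    have hsym : ContMDiffWithinAt 𝓘(ℝ, ℝ × 𝔼) I ∞
        (fun p : ℝ × 𝔼 => (extChartAt I x).symm p.2) S p :=
      (contMDiffOn_extChartAt_symm x p.2 hp.2).comp p contDiff_snd.contDiffWithinAt.contMDiffWithinAt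
        (fun q hq => hq.2)
    have hfst : ContMDiffWithinAt 𝓘(ℝ, ℝ × 𝔼) 𝓘(ℝ, ℝ) ∞ (fun p : ℝ × 𝔼 => p.1) S p :=
      contDiff_fst.contDiffWithinAt.contMDiffWithinAt
    have hsrc := (extChartAt I x).map_target hp.2
    have hβ := (hb (p.1, (extChartAt I x).symm p.2) ⟨hp.1, mem_univ _⟩).comp p
      (hfst.prodMk hsym) (fun q hq => mk_mem_prod hq.1 (mem_univ _))
    have hfr (A : Fin d) := (contMDiffAt_frame x hsrc A).comp_contMDiffWithinAt p hsym
    have : ContMDiffWithinAt 𝓘(ℝ, ℝ × 𝔼) (I.prod 𝓘(ℝ)) ∞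
        (fun p : ℝ × 𝔼 => TotalSpace.mk' ℝ (E := Bundle.Trivial N ℝ) ((extChartAt I x).symm p.2)
          (b p.1 ((extChartAt I x).symm p.2) (frame I x _ A) (frame I x _ B))) S p := by
      apply ContMDiffWithinAt.clm_bundle_apply₂ (F₁ := 𝔼) (F₂ := 𝔼)
      · exact hβ
      · exact hfr A
      · exact hfr B
    simp only [contMDiffWithinAt_totalSpace] at this
    exact this.2
  exact h1.congr fun p hp => gram_symm_apply _ hp.2 _ _

lemma isOpen_radii (a : EReal) : IsOpen (radii a) :=
  isOpen_Ioi.preimage continuous_coe_real_ereal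

lemma isMetricFamily_of_smoothFamily {a : EReal} {G : ℝ → SmoothMetric I (N := N)}
    (hG : SmoothFamily I a G) : IsMetricFamily (radii a) (fun r => (G r).inner) where
  isOpen := isOpen_radii a
  smooth := contDiffOn_gram (b := fun r => (G r).inner) hG
  symm r _ x := (G r).symm x
  pos r _ x := (G r).pos x

lemma isMetricFamily_const {R : Set ℝ} (hR : IsOpen R) (g : SmoothMetric I (N := N)) :
    IsMetricFamily R (fun _ => g.inner) where
  isOpen := hR
  smooth := contDiffOn_gram (b := fun _ => g.inner)
    (g.contMDiff.comp (contMDiff_snd (I := 𝓘(ℝ, ℝ)) (J := I))).contMDiffOn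
  symm _ _ x := g.symm x
  pos _ _ x := g.pos x

lemma isMetricFamily_warp {R : Set ℝ} (hR : IsOpen R) (g : SmoothMetric I (N := N)) {h : ℝ → ℝ}
    (hh : ContDiff ℝ ∞ h) (h0 : ∀ r ∈ R, h r ≠ 0) :
    IsMetricFamily R (warpFamily I h g.inner) where
  isOpen := hR
  smooth x A B := by
    simp only [gram_warpFamily, Matrix.smul_apply, smul_eq_mul]
    exact ((hh.comp contDiff_fst).pow 2).contDiffOn.mul ((isMetricFamily_const hR g).smooth x A B)
  symm r _ x v w := by simp only [warpFamily_apply, g.symm x v w]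
  pos r hr x v hv := by
    have := g.pos x v hv
    have := h0 r hr
    simp only [warpFamily_apply]
    positivity

lemma IsMetricFamily.posDef {R : Set ℝ} {b : ℝ → BilinField I N} (hb : IsMetricFamily R b)
    {r : ℝ} (hr : r ∈ R) {x : N} {y : 𝔼} (hy : y ∈ (extChartAt I x).target) :
    (gram I (b r) x y).PosDef := by
  have := gram_posDef (b r) ((extChartAt I x).map_target hy) (hb.symm r hr _) (hb.pos r hr _)
  rwa [(extChartAt I x).right_inv hy] at this

end Families

/-! ### Smoothness of determinants and inverses. -/

section MatrixSmoothness

variable {m : Type*} [Fintype m] [DecidableEq m] {V : Type*} [NormedAddCommGroup V]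
  [NormedSpace ℝ V] {M : V → Matrix m m ℝ} {T : Set V}

lemma contDiffOn_det (h : ∀ i j, ContDiffOn ℝ ∞ (fun p => M p i j) T) :
    ContDiffOn ℝ ∞ (fun p => (M p).det) T := by
  simp only [Matrix.det_apply]
  exact ContDiffOn.sum fun σ _ => (contDiffOn_prod fun i _ => h _ _).const_smul _

/-- Cramer's rule: the entries of the adjugate are determinants with one row replaced by a basis
vector. -/
lemma contDiffOn_inv_entry (h : ∀ i j, ContDiffOn ℝ ∞ (fun p => M p i j) T)
    (hu : ∀ p ∈ T, IsUnit (M p)) (i j : m) : ContDiffOn ℝ ∞ (fun p => (M p)⁻¹ i j) T := by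
  have hd : ∀ p ∈ T, (M p).det ≠ 0 := fun p hp =>
    ((Matrix.isUnit_iff_isUnit_det _).1 (hu p hp)).ne_zero
  simp only [Matrix.inv_def, Matrix.smul_apply, smul_eq_mul, Ring.inverse_eq_inv',
    Matrix.adjugate_apply]
  refine ((contDiffOn_det h).inv hd).mul (contDiffOn_det fun k l => ?_)
  by_cases hk : k = j
  · subst hk
    simp only [Matrix.updateRow_self]
    exact contDiffOn_const
  · simp only [Matrix.updateRow_ne hk]
    exact h k l

end MatrixSmoothness

/-! ### Partial derivatives in adapted coordinates, up to the boundary of `N`. -/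

section RadialDerivative

variable {d : ℕ} {H : Type*} [TopologicalSpace H]
  {I : ModelWithCorners ℝ (EuclideanSpace ℝ (Fin d)) H}
  {N : Type*} [TopologicalSpace N] [ChartedSpace H N]

local notation "𝔼" => EuclideanSpace ℝ (Fin d)

/-- `pd` differentiates within the whole of `univ ×ˢ range I`; by this lemma it only sees values on
the domain of the coordinates. -/
lemma mem_nhdsWithin_coords {R : Set ℝ} (hR : IsOpen R) {x : N} {p : ℝ × 𝔼}
    (hp : p ∈ R ×ˢ (extChartAt I x).target) :
    R ×ˢ (extChartAt I x).target ∈ 𝓝[univ ×ˢ range I] p := by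
  have h1 : (extChartAt I x).target ∈ 𝓝[range I] p.2 := extChartAt_target_mem_nhdsWithin_of_mem hp.2
  have h2 : R ∈ 𝓝[univ] p.1 := by rw [nhdsWithin_univ]; exact hR.mem_nhds hp.1
  obtain ⟨r, y⟩ := p
  rw [nhdsWithin_prod_eq]
  exact prod_mem_prod h2 h1

lemma uniqueDiffOn_coords : UniqueDiffOn ℝ ((univ : Set ℝ) ×ˢ range I) :=
  uniqueDiffOn_univ.prod I.uniqueDiffOn

lemma contDiffWithinAt_coords {R : Set ℝ} (hR : IsOpen R) {x : N} {F : ℝ × 𝔼 → ℝ}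
    (hF : ContDiffOn ℝ ∞ F (R ×ˢ (extChartAt I x).target)) {p : ℝ × 𝔼}
    (hp : p ∈ R ×ˢ (extChartAt I x).target) : ContDiffWithinAt ℝ ∞ F (univ ×ˢ range I) p :=
  (hF p hp).mono_of_mem_nhdsWithin (mem_nhdsWithin_coords hR hp)

lemma pd_congr {R : Set ℝ} (hR : IsOpen R) {x : N} {F F' : ℝ × 𝔼 → ℝ}
    (h : EqOn F F' (R ×ˢ (extChartAt I x).target)) (i : Idx d) {p : ℝ × 𝔼}
    (hp : p ∈ R ×ˢ (extChartAt I x).target) : pd I F i p = pd I F' i p := by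
  unfold pd
  rw [Filter.EventuallyEq.fderivWithin_eq (eventually_of_mem (mem_nhdsWithin_coords hR hp) h)
    (h hp)]

lemma contDiffOn_pd {R : Set ℝ} (hR : IsOpen R) {x : N} {F : ℝ × 𝔼 → ℝ}
    (hF : ContDiffOn ℝ ∞ F (R ×ˢ (extChartAt I x).target)) (i : Idx d) :
    ContDiffOn ℝ ∞ (pd I F i) (R ×ˢ (extChartAt I x).target) := by
  have hsub : R ×ˢ (extChartAt I x).target ⊆ (univ : Set ℝ) ×ˢ range I :=
    prod_mono (subset_univ _) (extChartAt_target_subset_range x)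
  intro p hp
  have h1 := (contDiffWithinAt_coords hR hF hp).fderivWithin_right (m := ∞) uniqueDiffOn_coords
    (by simp) (hsub hp)
  exact (h1.clm_apply contDiffWithinAt_const).mono hsub

/-- The line `s ↦ (s, y)` never leaves `univ ×ˢ range I`, so the radial derivative is two-sided even
at boundary points of `N`. -/
lemma hasDerivAt_pd {R : Set ℝ} (hR : IsOpen R) {x : N} {F : ℝ × 𝔼 → ℝ}
    (hF : ContDiffOn ℝ ∞ F (R ×ˢ (extChartAt I x).target)) {r : ℝ} {y : 𝔼}
    (hr : r ∈ R) (hy : y ∈ (extChartAt I x).target) :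
    HasDerivAt (fun s => F (s, y)) (pd I F (rIdx d) (r, y)) r := by
  have h1 := ((contDiffWithinAt_coords hR hF (mk_mem_prod hr hy)).differentiableWithinAt
    (by simp)).hasFDerivWithinAt
  have h2 : HasDerivAt (fun s : ℝ => (s, y)) ((1 : ℝ), (0 : 𝔼)) r :=
    (hasDerivAt_id r).prodMk (hasDerivAt_const r y)
  exact HasFDerivWithinAt.comp_hasDerivAt (f := fun s : ℝ => (s, y)) r h1 h2
    (Eventually.of_forall fun s => ⟨mem_univ _, extChartAt_target_subset_range x hy⟩)

end RadialDerivative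

/-! ### Christoffel symbols, mean curvature and radial Ricci curvature of `dr² + G(r)`. -/

section Curvature

variable {d : ℕ} {H : Type*} [TopologicalSpace H]
  (I : ModelWithCorners ℝ (EuclideanSpace ℝ (Fin d)) H)
  {N : Type*} [TopologicalSpace N] [ChartedSpace H N]

local notation "𝔼" => EuclideanSpace ℝ (Fin d)

/-- The matrix of radial derivatives of the components of a family of bilinear forms. -/
noncomputable def gramDeriv (b : ℝ → BilinField I N) (x : N) (p : ℝ × 𝔼) :
    Matrix (Fin d) (Fin d) ℝ :=
  Matrix.of fun A B => pd I (fun q => gram I (b q.1) x q.2 A B) (rIdx d) p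

/-- The matrix of second radial derivatives of the components of a family of bilinear forms. -/
noncomputable def gramDeriv₂ (b : ℝ → BilinField I N) (x : N) (p : ℝ × 𝔼) :
    Matrix (Fin d) (Fin d) ℝ :=
  Matrix.of fun A B => pd I (fun q => gramDeriv I b x q A B) (rIdx d) p

/-- The endomorphism `G⁻¹ ∂_r G`, in coordinates. -/
noncomputable def logDeriv (b : ℝ → BilinField I N) (x : N) (p : ℝ × 𝔼) :
    Matrix (Fin d) (Fin d) ℝ :=
  (gram I (b p.1) x p.2)⁻¹ * gramDeriv I b x p

/-- The endomorphism `G⁻¹ ∂_r² G`, in coordinates. -/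
noncomputable def logDeriv₂ (b : ℝ → BilinField I N) (x : N) (p : ℝ × 𝔼) :
    Matrix (Fin d) (Fin d) ℝ :=
  (gram I (b p.1) x p.2)⁻¹ * gramDeriv₂ I b x p

variable {I} {R : Set ℝ} {b : ℝ → BilinField I N}

lemma IsMetricFamily.contDiffOn_gramDeriv (hb : IsMetricFamily R b) (x : N) (A B : Fin d) :
    ContDiffOn ℝ ∞ (fun p => gramDeriv I b x p A B) (R ×ˢ (extChartAt I x).target) :=
  contDiffOn_pd hb.isOpen (hb.smooth x A B) _

lemma IsMetricFamily.contDiffOn_gramDeriv₂ (hb : IsMetricFamily R b) (x : N) (A B : Fin d) :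
    ContDiffOn ℝ ∞ (fun p => gramDeriv₂ I b x p A B) (R ×ˢ (extChartAt I x).target) :=
  contDiffOn_pd hb.isOpen (hb.contDiffOn_gramDeriv x A B) _

lemma IsMetricFamily.hasDerivAt_gram (hb : IsMetricFamily R b) {x : N} {r : ℝ} {y : 𝔼}
    (hr : r ∈ R) (hy : y ∈ (extChartAt I x).target) (A B : Fin d) :
    HasDerivAt (fun s => gram I (b s) x y A B) (gramDeriv I b x (r, y) A B) r :=
  hasDerivAt_pd hb.isOpen (hb.smooth x A B) hr hy

lemma IsMetricFamily.hasDerivAt_gramDeriv (hb : IsMetricFamily R b) {x : N} {r : ℝ} {y : 𝔼}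
    (hr : r ∈ R) (hy : y ∈ (extChartAt I x).target) (A B : Fin d) :
    HasDerivAt (fun s => gramDeriv I b x (s, y) A B) (gramDeriv₂ I b x (r, y) A B) r :=
  hasDerivAt_pd hb.isOpen (hb.contDiffOn_gramDeriv x A B) hr hy

lemma pd_const (c : ℝ) (i : Idx d) (p : ℝ × 𝔼) : pd I (fun _ => c) i p = 0 := by
  simp [pd]

lemma pd_metricComp_inl_left (x : N) (l i : Idx d) (p : ℝ × 𝔼) :
    pd I (fun q => metricComp I b x q (Sum.inl ()) l) i p = 0 := by
  rcases l with l | l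
  · exact pd_const _ _ _
  · exact pd_const 0 _ _

lemma pd_metricComp_inl_right (x : N) (l i : Idx d) (p : ℝ × 𝔼) :
    pd I (fun q => metricComp I b x q l (Sum.inl ())) i p = 0 := by
  rcases l with l | l
  · exact pd_const _ _ _
  · exact pd_const 0 _ _

/-- Only derivatives of `g_{lr}` enter, and these components are constant: the radial lines are
geodesics. -/
lemma christoffel_inl_inl (x : N) (i : Idx d) (p : ℝ × 𝔼) :
    christoffel I b x i (Sum.inl ()) (Sum.inl ()) p = 0 := by
  simp [christoffel, pd_metricComp_inl_right, -Fintype.sum_sum_type]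

variable [IsManifold I ∞ N]

lemma IsMetricFamily.inv_metricComp (hb : IsMetricFamily R b) {x : N} {p : ℝ × 𝔼}
    (hp : p ∈ R ×ˢ (extChartAt I x).target) :
    (metricComp I b x p)⁻¹ = Matrix.fromBlocks 1 0 0 (gram I (b p.1) x p.2)⁻¹ := by
  have hu := (hb.posDef hp.1 hp.2).isUnit
  rw [metricComp, Matrix.inv_fromBlocks_zero₂₁_of_isUnit_iff _ _ _ (by simp [hu])]
  simp

lemma IsMetricFamily.christoffel_inl (hb : IsMetricFamily R b) {x : N} {p : ℝ × 𝔼}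
    (hp : p ∈ R ×ˢ (extChartAt I x).target) (k : Idx d) :
    christoffel I b x (Sum.inl ()) (Sum.inl ()) k p = 0 ∧
      christoffel I b x (Sum.inl ()) k (Sum.inl ()) p = 0 := by
  simp [christoffel, hb.inv_metricComp hp, pd_metricComp_inl_left, pd_metricComp_inl_right]

/-- As `g⁻¹` is block diagonal and the `g_{rl}` are constant, `½ g^{BC} ∂_r g_{CA}` is all that
survives. Hence `G⁻¹ ∂_r G = 2 S`. -/
lemma IsMetricFamily.christoffel_inr (hb : IsMetricFamily R b) {x : N} {p : ℝ × 𝔼}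
    (hp : p ∈ R ×ˢ (extChartAt I x).target) (A B : Fin d) :
    christoffel I b x (Sum.inr B) (Sum.inr A) (Sum.inl ()) p = (1 / 2) * logDeriv I b x p B A ∧
      christoffel I b x (Sum.inr B) (Sum.inl ()) (Sum.inr A) p =
        (1 / 2) * logDeriv I b x p B A := by
  constructor <;>
  · simp only [christoffel, hb.inv_metricComp hp, Fintype.sum_sum_type, pd_metricComp_inl_left,
      pd_metricComp_inl_right, Matrix.fromBlocks_apply₂₁, Matrix.fromBlocks_apply₂₂, logDeriv,
      Matrix.mul_apply, Matrix.zero_apply, zero_mul, Finset.sum_const_zero, zero_add, add_zero,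
      sub_zero]
    rfl

lemma IsMetricFamily.contDiffOn_logDeriv (hb : IsMetricFamily R b) (x : N) (A B : Fin d) :
    ContDiffOn ℝ ∞ (fun p => logDeriv I b x p A B) (R ×ˢ (extChartAt I x).target) := by
  simp only [logDeriv, Matrix.mul_apply]
  exact ContDiffOn.sum fun C _ => (contDiffOn_inv_entry (hb.smooth x)
    (fun p hp => (hb.posDef hp.1 hp.2).isUnit) A C).mul (hb.contDiffOn_gramDeriv x C B)

lemma IsMetricFamily.contDiffOn_logDeriv₂ (hb : IsMetricFamily R b) (x : N) (A B : Fin d) :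
    ContDiffOn ℝ ∞ (fun p => logDeriv₂ I b x p A B) (R ×ˢ (extChartAt I x).target) := by
  simp only [logDeriv₂, Matrix.mul_apply]
  exact ContDiffOn.sum fun C _ => (contDiffOn_inv_entry (hb.smooth x)
    (fun p hp => (hb.posDef hp.1 hp.2).isUnit) A C).mul (hb.contDiffOn_gramDeriv₂ x C B)

/-- The radial derivative of `tr (G⁻¹ ∂_r G)`. -/
lemma IsMetricFamily.hasDerivAt_trace_logDeriv (hb : IsMetricFamily R b) {x : N} {r : ℝ} {y : 𝔼}
    (hr : r ∈ R) (hy : y ∈ (extChartAt I x).target) :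
    HasDerivAt (fun s => (logDeriv I b x (s, y)).trace)
      ((logDeriv₂ I b x (r, y)).trace -
        (logDeriv I b x (r, y) * logDeriv I b x (r, y)).trace) r :=
  hasDerivAt_trace_inv_mul (A := fun s => gram I (b s) x y)
    (B := fun s => gramDeriv I b x (s, y)) (hb.hasDerivAt_gram hr hy)
    (hb.hasDerivAt_gramDeriv hr hy) (hb.posDef hr hy).isUnit

/-- The mean curvature is `½ tr (G⁻¹ ∂_r G)`. -/
lemma IsMetricFamily.meanCurv_eq (hb : IsMetricFamily R b) {r : ℝ} (hr : r ∈ R) (x : N) :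
    meanCurv I b r x = (1 / 2) * (logDeriv I b x (r, extChartAt I x x)).trace := by
  have hp : (r, extChartAt I x x) ∈ R ×ˢ (extChartAt I x).target := ⟨hr, mem_extChartAt_target x⟩
  simp only [meanCurv, weingarten, Matrix.trace, Matrix.diag, Matrix.of_apply,
    (hb.christoffel_inr hp _ _).1, Finset.mul_sum]

/-- The radial Ricci curvature is `-½ tr (G⁻¹ ∂_r² G) + ¼ tr ((G⁻¹ ∂_r G)²)`. -/
lemma IsMetricFamily.ricciRR_eq (hb : IsMetricFamily R b) {r : ℝ} (hr : r ∈ R) (x : N) :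
    ricciRR I b r x = -(1 / 2) * (logDeriv₂ I b x (r, extChartAt I x x)).trace +
      (1 / 4) * (logDeriv I b x (r, extChartAt I x x) *
        logDeriv I b x (r, extChartAt I x x)).trace := by
  have hy := mem_extChartAt_target (I := I) x
  set y := extChartAt I x x
  have hp : (r, y) ∈ R ×ˢ (extChartAt I x).target := ⟨hr, hy⟩
  have h0 (i j : Idx d) : pd I (christoffel I b x i (Sum.inl ()) (Sum.inl ())) j (r, y) = 0 := by
    have : christoffel I b x i (Sum.inl ()) (Sum.inl ()) = fun _ => 0 := by
      funext p; exact christoffel_inl_inl x i p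
    rw [this, pd_const]
  -- In `R_rr` only `-∂_r Γ^A_{Ar}` and `-Γ^A_{rB} Γ^B_{Ar}` survive. This is the sum in the first
  -- of them; `h2` below treats the second.
  have h1 : ∑ A, pd I (christoffel I b x (Sum.inr A) (Sum.inr A) (Sum.inl ())) (Sum.inl ()) (r, y)
      = (1 / 2) * ((logDeriv₂ I b x (r, y)).trace -
        (logDeriv I b x (r, y) * logDeriv I b x (r, y)).trace) := by
    have e (A : Fin d) : HasDerivAt (fun s => (1 / 2) * logDeriv I b x (s, y) A A)
        (pd I (christoffel I b x (Sum.inr A) (Sum.inr A) (Sum.inl ())) (Sum.inl ()) (r, y)) r := by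
      rw [pd_congr hb.isOpen (F' := fun p => (1 / 2) * logDeriv I b x p A A)
        (fun p hp => (hb.christoffel_inr hp A A).1) _ hp]
      exact hasDerivAt_pd hb.isOpen (contDiffOn_const.mul (hb.contDiffOn_logDeriv x A A)) hr hy
    have e1 := HasDerivAt.fun_sum (u := Finset.univ) fun A _ => e A
    have e2 := (hb.hasDerivAt_trace_logDeriv hr hy).const_mul (1 / 2)
    simp only [Matrix.trace, Matrix.diag, Finset.mul_sum] at e2
    rw [e1.unique e2]
    simp only [Matrix.trace, Matrix.diag]
  change ricciComp I b x (Sum.inl ()) (Sum.inl ()) (r, y) = _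
  simp only [ricciComp, Fintype.sum_sum_type, Finset.univ_unique,
    PUnit.default_eq_unit, h0, christoffel_inl_inl, (hb.christoffel_inl hp _).1,
    (hb.christoffel_inl hp _).2, (hb.christoffel_inr hp _ _).1, (hb.christoffel_inr hp _ _).2,
    mul_zero, zero_mul, Finset.sum_const_zero, add_zero, zero_add, zero_sub]
  rw [h1]
  have h2 : ∑ A, ∑ B, 1 / 2 * logDeriv I b x (r, y) A B * (1 / 2 * logDeriv I b x (r, y) B A) =
      (1 / 4) * (logDeriv I b x (r, y) * logDeriv I b x (r, y)).trace := by
    simp only [Matrix.trace, Matrix.diag, Matrix.mul_apply, Finset.mul_sum]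
    refine Finset.sum_congr rfl fun A _ => Finset.sum_congr rfl fun B _ => ?_
    ring
  rw [h2]
  ring

end Curvature

/-! ### Chart independence and continuity of the traces. -/

section Invariance

lemma hasDerivAt_congruence {m : Type*} [Fintype m] {M : ℝ → Matrix m m ℝ} {M' P : Matrix m m ℝ}
    {r : ℝ} (h : ∀ i j, HasDerivAt (fun s => M s i j) (M' i j) r) (i j : m) :
    HasDerivAt (fun s => (P.transpose * M s * P) i j) ((P.transpose * M' * P) i j) r := by
  simp only [Matrix.mul_apply]
  exact HasDerivAt.fun_sum fun k _ => (HasDerivAt.fun_sum fun l _ =>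
    (h l k).const_mul _).mul_const _

variable {d : ℕ} {H : Type*} [TopologicalSpace H]
  {I : ModelWithCorners ℝ (EuclideanSpace ℝ (Fin d)) H}
  {N : Type*} [TopologicalSpace N] [ChartedSpace H N]

/-- A function on `R × N` that is continuous in the coordinates of every chart is continuous. -/
lemma continuousOn_of_charts {R : Set ℝ} {f : ℝ × N → ℝ}
    (F : N → ℝ × EuclideanSpace ℝ (Fin d) → ℝ)
    (hF : ∀ x, ContinuousOn (F x) (R ×ˢ (extChartAt I x).target))
    (h : ∀ x z, z ∈ (extChartAt I x).source → ∀ r ∈ R, f (r, z) = F x (r, extChartAt I x z)) :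
    ContinuousOn f (R ×ˢ univ) := by
  rintro ⟨r, x⟩ ⟨hr, -⟩
  have hx := mem_extChartAt_source (I := I) x
  have hS : R ×ˢ (extChartAt I x).source ∈ 𝓝[R ×ˢ univ] (r, x) := by
    rw [nhdsWithin_prod_eq, nhdsWithin_univ]
    exact prod_mem_prod self_mem_nhdsWithin (extChartAt_source_mem_nhds x)
  have hc : ContinuousOn (fun p : ℝ × N => F x (p.1, extChartAt I x p.2))
      (R ×ˢ (extChartAt I x).source) := by
    refine (hF x).comp (continuousOn_fst.prodMk ((continuousOn_extChartAt x).comp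
      continuousOn_snd fun p hp => hp.2)) fun p hp => ⟨hp.1, (extChartAt I x).map_source hp.2⟩
  have := (hc.congr fun p hp => h x p.2 hp.2 p.1 hp.1) (r, x) ⟨hr, hx⟩
  exact this.mono_of_mem_nhdsWithin hS

variable [IsManifold I ∞ N] {R : Set ℝ} {b : ℝ → BilinField I N}

/-- The Jacobian does not depend on `r`, so radial derivatives of the components transform as the
components do. -/
lemma IsMetricFamily.gramDeriv_change (hb : IsMetricFamily R b) {x x' z : N}
    (hz : z ∈ (extChartAt I x).source) (hz' : z ∈ (extChartAt I x').source) {r : ℝ} (hr : r ∈ R) :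
    gramDeriv I b x (r, extChartAt I x z) = (jacobian I x x' z).transpose *
      gramDeriv I b x' (r, extChartAt I x' z) * jacobian I x x' z := by
  ext A B
  have h1 := hb.hasDerivAt_gram hr ((extChartAt I x).map_source hz) A B
  simp only [gram_change _ hz hz'] at h1
  exact h1.unique
    (hasDerivAt_congruence (hb.hasDerivAt_gram hr ((extChartAt I x').map_source hz')) A B)

lemma IsMetricFamily.gramDeriv₂_change (hb : IsMetricFamily R b) {x x' z : N}
    (hz : z ∈ (extChartAt I x).source) (hz' : z ∈ (extChartAt I x').source) {r : ℝ} (hr : r ∈ R) :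
    gramDeriv₂ I b x (r, extChartAt I x z) = (jacobian I x x' z).transpose *
      gramDeriv₂ I b x' (r, extChartAt I x' z) * jacobian I x x' z := by
  ext A B
  have h1 := hb.hasDerivAt_gramDeriv hr ((extChartAt I x).map_source hz) A B
  refine h1.unique ((hasDerivAt_congruence (P := jacobian I x x' z)
    (hb.hasDerivAt_gramDeriv hr ((extChartAt I x').map_source hz')) A B).congr_of_eventuallyEq ?_)
  filter_upwards [hb.isOpen.mem_nhds hr] with s hs
  rw [hb.gramDeriv_change hz hz' hs]

/-- A change of chart conjugates `G⁻¹ ∂_r G` and `G⁻¹ ∂_r² G` by the Jacobian. This is what makes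
the functions below continuous, since they are computed in a chart that varies with the point. -/
lemma IsMetricFamily.traces_change (hb : IsMetricFamily R b) {x x' z : N}
    (hz : z ∈ (extChartAt I x).source) (hz' : z ∈ (extChartAt I x').source) {r : ℝ} (hr : r ∈ R) :
    (logDeriv I b x (r, extChartAt I x z)).trace =
      (logDeriv I b x' (r, extChartAt I x' z)).trace ∧
    (logDeriv₂ I b x (r, extChartAt I x z)).trace =
      (logDeriv₂ I b x' (r, extChartAt I x' z)).trace ∧
    (logDeriv I b x (r, extChartAt I x z) * logDeriv I b x (r, extChartAt I x z)).trace =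
      (logDeriv I b x' (r, extChartAt I x' z) * logDeriv I b x' (r, extChartAt I x' z)).trace := by
  have hP := isUnit_det_jacobian hz hz'
  have h1 : logDeriv I b x (r, extChartAt I x z) = (jacobian I x x' z)⁻¹ *
      logDeriv I b x' (r, extChartAt I x' z) * jacobian I x x' z := by
    rw [logDeriv, hb.gramDeriv_change hz hz' hr, gram_change _ hz hz', inv_mul_congr hP]
    rfl
  have h2 : logDeriv₂ I b x (r, extChartAt I x z) = (jacobian I x x' z)⁻¹ *
      logDeriv₂ I b x' (r, extChartAt I x' z) * jacobian I x x' z := by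
    rw [logDeriv₂, hb.gramDeriv₂_change hz hz' hr, gram_change _ hz hz', inv_mul_congr hP]
    rfl
  rw [h1, h2]
  exact ⟨trace_conj_inv hP, trace_conj_inv hP, trace_conj_inv_sq hP⟩

variable (I) in
/-- The function `tr (G⁻¹ ∂_r G)` on `R × N`. -/
noncomputable def traceDeriv (b : ℝ → BilinField I N) (p : ℝ × N) : ℝ :=
  (logDeriv I b p.2 (p.1, extChartAt I p.2 p.2)).trace

variable (I) in
/-- The function `tr (G⁻¹ ∂_r² G)` on `R × N`. -/
noncomputable def traceDeriv₂ (b : ℝ → BilinField I N) (p : ℝ × N) : ℝ :=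
  (logDeriv₂ I b p.2 (p.1, extChartAt I p.2 p.2)).trace

variable (I) in
/-- The function `tr ((G⁻¹ ∂_r G)²)` on `R × N`. -/
noncomputable def traceDerivSq (b : ℝ → BilinField I N) (p : ℝ × N) : ℝ :=
  (logDeriv I b p.2 (p.1, extChartAt I p.2 p.2) *
    logDeriv I b p.2 (p.1, extChartAt I p.2 p.2)).trace

lemma IsMetricFamily.continuousOn_traceDeriv (hb : IsMetricFamily R b) :
    ContinuousOn (traceDeriv I b) (R ×ˢ univ) :=
  continuousOn_of_charts (fun x p => (logDeriv I b x p).trace)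
    (fun x => by
      simp only [Matrix.trace, Matrix.diag]
      exact continuousOn_finsetSum _ fun A _ => (hb.contDiffOn_logDeriv x A A).continuousOn)
    fun _ z hz _ hr => (hb.traces_change hz (mem_extChartAt_source z) hr).1.symm

lemma IsMetricFamily.continuousOn_traceDeriv₂ (hb : IsMetricFamily R b) :
    ContinuousOn (traceDeriv₂ I b) (R ×ˢ univ) :=
  continuousOn_of_charts (fun x p => (logDeriv₂ I b x p).trace)
    (fun x => by
      simp only [Matrix.trace, Matrix.diag]
      exact continuousOn_finsetSum _ fun A _ => (hb.contDiffOn_logDeriv₂ x A A).continuousOn)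
    fun _ z hz _ hr => (hb.traces_change hz (mem_extChartAt_source z) hr).2.1.symm

lemma IsMetricFamily.continuousOn_traceDerivSq (hb : IsMetricFamily R b) :
    ContinuousOn (traceDerivSq I b) (R ×ˢ univ) :=
  continuousOn_of_charts (fun x p => (logDeriv I b x p * logDeriv I b x p).trace)
    (fun x => by
      simp only [Matrix.trace, Matrix.diag, Matrix.mul_apply]
      exact continuousOn_finsetSum _ fun A _ => continuousOn_finsetSum _ fun B _ =>
        (hb.contDiffOn_logDeriv x A B).continuousOn.mul (hb.contDiffOn_logDeriv x B A).continuousOn)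
    fun _ z hz _ hr => (hb.traces_change hz (mem_extChartAt_source z) hr).2.2.symm

lemma IsMetricFamily.hasDerivAt_traceDeriv (hb : IsMetricFamily R b) {r : ℝ} (hr : r ∈ R) (x : N) :
    HasDerivAt (fun s => traceDeriv I b (s, x)) (traceDeriv₂ I b (r, x) - traceDerivSq I b (r, x))
      r := by
  have h := hb.hasDerivAt_trace_logDeriv (y := extChartAt I x x) hr (mem_extChartAt_target x)
  simp only [traceDeriv, traceDeriv₂, traceDerivSq]
  exact h

end Invariance

/-! ### The Riemannian measure is finite and positive on open sets. -/

section Volume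

variable {d : ℕ} {H : Type*} [TopologicalSpace H]
  {I : ModelWithCorners ℝ (EuclideanSpace ℝ (Fin d)) H}
  {N : Type*} [TopologicalSpace N] [ChartedSpace H N]

local notation "𝔼" => EuclideanSpace ℝ (Fin d)

lemma measurableSet_extChartAt_target (x : N) : MeasurableSet (extChartAt I x).target := by
  rw [extChartAt_target]
  exact ((chartAt H x).open_target.preimage I.continuous_symm).measurableSet.inter
    I.isClosed_range.measurableSet

lemma continuousOn_sqrt_det_gram [IsManifold I ∞ N] (g : SmoothMetric I (N := N)) (x : N) :
    ContinuousOn (fun y => Real.sqrt (gram I g.inner x y).det) (extChartAt I x).target := by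
  have hg := isMetricFamily_const isOpen_univ g
  have h1 := contDiffOn_det (M := fun p : ℝ × 𝔼 => gram I g.inner x p.2) (hg.smooth x)
  have h2 : ContinuousOn (fun y : 𝔼 => ((0 : ℝ), y)) (extChartAt I x).target := by fun_prop
  exact (h1.continuousOn.comp h2 fun y hy => ⟨mem_univ _, hy⟩).sqrt

variable [MeasurableSpace N] [BorelSpace N]

lemma measurableSet_inter_symm_preimage (x : N) {S : Set N} (hS : MeasurableSet S) :
    MeasurableSet ((extChartAt I x).symm ⁻¹' S ∩ (extChartAt I x).target) := by
  have hc := (continuousOn_extChartAt_symm (I := I) x).domRestrict.measurable hS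
  have := (measurableSet_extChartAt_target (I := I) x).subtype_image hc
  convert this using 1
  ext y
  constructor
  · rintro ⟨h1, h2⟩; exact ⟨⟨y, h2⟩, h1, rfl⟩
  · rintro ⟨⟨y', h2⟩, h1, rfl⟩; exact ⟨h1, h2⟩

lemma chartVolume_apply (b : BilinField I N) (x : N) {S : Set N} (hS : MeasurableSet S) :
    chartVolume I b x S = ∫⁻ y in (extChartAt I x).symm ⁻¹' S ∩ (extChartAt I x).target,
      ENNReal.ofReal (Real.sqrt (gram I b x y).det) := by
  have hae : AEMeasurable (extChartAt I x).symm
      ((volume.restrict (extChartAt I x).target).withDensity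
        (fun y => ENNReal.ofReal (Real.sqrt (gram I b x y).det))) :=
    ((continuousOn_extChartAt_symm x).aemeasurable (measurableSet_extChartAt_target x)).mono_ac
      (withDensity_absolutelyContinuous _ _)
  rw [chartVolume, Measure.map_apply_of_aemeasurable hae hS, withDensity_apply',
    Measure.restrict_restrict' (measurableSet_extChartAt_target x)]

lemma chartVolume_inter_source (b : BilinField I N) (x : N) {S : Set N} (hS : MeasurableSet S) :
    chartVolume I b x S = chartVolume I b x (S ∩ (extChartAt I x).source) := by
  rw [chartVolume_apply b x hS,
    chartVolume_apply b x (hS.inter (isOpen_extChartAt_source x).measurableSet)]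
  congr 2
  ext y
  constructor
  · rintro ⟨h1, h2⟩; exact ⟨⟨h1, (extChartAt I x).map_target h2⟩, h2⟩
  · rintro ⟨⟨h1, -⟩, h2⟩; exact ⟨h1, h2⟩

variable [IsManifold I ∞ N]

/-- The chart measures agree on the overlap of two charts. -/
lemma chartVolume_eq_of_subset (b : BilinField I N) {x x' : N} {S : Set N} (hS : MeasurableSet S)
    (h : S ⊆ (extChartAt I x).source) (h' : S ⊆ (extChartAt I x').source) :
    chartVolume I b x S = chartVolume I b x' S := by
  set D := (extChartAt I x).symm ⁻¹' S ∩ (extChartAt I x).target with hD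
  set φ : 𝔼 → 𝔼 := extChartAt I x' ∘ (extChartAt I x).symm with hφ
  have hDm : MeasurableSet D := measurableSet_inter_symm_preimage x hS
  have himg : φ '' D = (extChartAt I x').symm ⁻¹' S ∩ (extChartAt I x').target := by
    ext y
    constructor
    · rintro ⟨y, ⟨h1, h2⟩, rfl⟩
      refine ⟨?_, (extChartAt I x').map_source (h' h1)⟩
      simp only [hφ, Function.comp_apply, mem_preimage, (extChartAt I x').left_inv (h' h1)]
      exact h1
    · rintro ⟨h1, h2⟩
      refine ⟨extChartAt I x ((extChartAt I x').symm y), ⟨?_, (extChartAt I x).map_source (h h1)⟩,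
        ?_⟩
      · simp only [mem_preimage, (extChartAt I x).left_inv (h h1)]
        exact h1
      · simp only [hφ, Function.comp_apply, (extChartAt I x).left_inv (h h1),
          (extChartAt I x').right_inv h2]
  -- The change of variables formula needs only derivatives within `D`, so boundary points require
  -- no separate treatment.
  have hder : ∀ y ∈ D, HasFDerivWithinAt φ
      (tangentCoordChange I x x' ((extChartAt I x).symm y)) D y := by
    rintro y ⟨h1, h2⟩
    have := hasFDerivWithinAt_tangentCoordChange (I := I) ⟨h h1, h' h1⟩
    rw [(extChartAt I x).right_inv h2] at this
    exact this.mono fun y hy => extChartAt_target_subset_range x hy.2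
  have hinj : InjOn φ D := by
    rintro y ⟨h1, h2⟩ w ⟨h3, h4⟩ hyw
    have := (extChartAt I x').injOn (h' h1) (h' h3) hyw
    exact (extChartAt I x).symm.injOn h2 h4 this
  rw [chartVolume_apply b x hS, chartVolume_apply b x' hS, ← himg,
    lintegral_image_eq_lintegral_abs_det_fderiv_mul volume hDm hder hinj]
  refine setLIntegral_congr_fun hDm ?_
  rintro y ⟨h1, h2⟩
  -- The determinant of the components picks up the squared Jacobian determinant, whose root is the
  -- factor in the change of variables.
  have hg := gram_change b (h h1) (h' h1)
  rw [(extChartAt I x).right_inv h2] at hg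
  simp only [hg, ← det_jacobian, Matrix.det_mul, Matrix.det_transpose]
  rw [← ENNReal.ofReal_mul (abs_nonneg _)]
  congr 1
  set δ := (jacobian I x x' ((extChartAt I x).symm y)).det
  rw [show ∀ t : ℝ, δ * t * δ = δ ^ 2 * t by intro t; ring, Real.sqrt_mul (sq_nonneg _),
    Real.sqrt_sq_eq_abs]
  rfl

lemma chartVolume_lt_top (g : SmoothMetric I (N := N)) {x : N} {K : Set N} (hK : IsCompact K)
    (hKm : MeasurableSet K) (hKx : K ⊆ (extChartAt I x).source) :
    chartVolume I g.inner x K < ⊤ := by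
  rw [chartVolume_apply _ x hKm]
  have himg : (extChartAt I x).symm ⁻¹' K ∩ (extChartAt I x).target = extChartAt I x '' K := by
    ext y
    constructor
    · rintro ⟨h1, h2⟩
      exact ⟨_, h1, (extChartAt I x).right_inv h2⟩
    · rintro ⟨z, hz, rfl⟩
      refine ⟨?_, (extChartAt I x).map_source (hKx hz)⟩
      simp only [mem_preimage, (extChartAt I x).left_inv (hKx hz)]
      exact hz
  have hc : IsCompact (extChartAt I x '' K) :=
    hK.image_of_continuousOn ((continuousOn_extChartAt x).mono hKx)
  rw [himg]
  refine IntegrableOn.setLIntegral_lt_top (ContinuousOn.integrableOn_compact hc ?_)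
  refine (continuousOn_sqrt_det_gram g x).mono ?_
  rw [← himg]
  exact inter_subset_right

/-- A single chart measure suffices: in coordinates an open set contains a closed ball, on which the
continuous positive density is bounded below. -/
instance isOpenPosMeasure_riemVolume (g : SmoothMetric I (N := N)) :
    (riemVolume I g.inner).IsOpenPosMeasure := by
  refine ⟨fun U hU ⟨x, hxU⟩ => ?_⟩
  have hle : chartVolume I g.inner x U ≤ riemVolume I g.inner U := le_iSup (chartVolume I g.inner) x U
  refine (lt_of_lt_of_le ?_ hle).ne'
  rw [chartVolume_apply _ x hU.measurableSet]
  set D := (extChartAt I x).symm ⁻¹' U ∩ (extChartAt I x).target with hD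
  have hDn : D ∈ 𝓝[range I] (extChartAt I x x) := by
    refine inter_mem ?_ (extChartAt_target_mem_nhdsWithin x)
    have hc := (continuousAt_extChartAt_symm (I := I) x)
    refine mem_nhdsWithin_of_mem_nhds (hc ?_)
    rw [extChartAt_to_inv]
    exact hU.mem_nhds hxU
  obtain ⟨V, hVo, hpV, hVD⟩ := mem_nhdsWithin.1 hDn
  -- If `x` is a boundary point, one moves to a nearby interior point of `range I`.
  obtain ⟨y, hyV, hyI⟩ := mem_closure_iff.1
    (I.range_subset_closure_interior (extChartAt_target_subset_range x (mem_extChartAt_target x)))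
    V hVo hpV
  obtain ⟨ε, hε, hball⟩ := Metric.nhds_basis_closedBall.mem_iff.1
    ((hVo.inter isOpen_interior).mem_nhds ⟨hyV, hyI⟩)
  have hBD : Metric.closedBall y ε ⊆ D := fun z hz =>
    hVD ⟨(hball hz).1, interior_subset (hball hz).2⟩
  have hc := (continuousOn_sqrt_det_gram g x).mono (hBD.trans inter_subset_right)
  obtain ⟨z, hz, hmin⟩ := (isCompact_closedBall y ε).exists_isMinOn
    ⟨y, Metric.mem_closedBall_self hε.le⟩ hc
  have hpos : 0 < Real.sqrt (gram I g.inner x z).det :=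
    Real.sqrt_pos.2 ((isMetricFamily_const isOpen_univ g).posDef (mem_univ (0 : ℝ))
      (hBD hz).2).det_pos
  calc (0 : ENNReal) < ENNReal.ofReal (Real.sqrt (gram I g.inner x z).det) *
        volume (Metric.closedBall y ε) := by
        refine ENNReal.mul_pos (ENNReal.ofReal_pos.2 hpos).ne' ?_
        exact (Metric.measure_closedBall_pos volume y hε).ne'
    _ = ∫⁻ _ in Metric.closedBall y ε, ENNReal.ofReal (Real.sqrt (gram I g.inner x z).det) := by
        rw [setLIntegral_const]
    _ ≤ ∫⁻ w in Metric.closedBall y ε, ENNReal.ofReal (Real.sqrt (gram I g.inner x w).det) :=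
        setLIntegral_mono' Metric.isClosed_closedBall.measurableSet fun w hw =>
          ENNReal.ofReal_le_ofReal (hmin hw)
    _ ≤ _ := lintegral_mono_set hBD

variable [T2Space N] [CompactSpace N]

/-- Finitely many compact sets `K i`, each inside a chart, cover `N`. By agreement on overlaps,
every chart measure is at most the sum `ν` of the chart measures restricted to the `K i`, hence so
is their supremum; `ν` is finite. -/
instance isFiniteMeasure_riemVolume (g : SmoothMetric I (N := N)) :
    IsFiniteMeasure (riemVolume I g.inner) := by
  have hlc (x : N) : ∃ K : Set N, IsCompact K ∧ K ∈ 𝓝 x ∧ K ⊆ (extChartAt I x).source := by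
    obtain ⟨K, h1, h2, h3⟩ := local_compact_nhds (extChartAt_source_mem_nhds (I := I) x)
    exact ⟨K, h3, h1, h2⟩
  choose K hKc hKn hKs using hlc
  obtain ⟨t, -, ht⟩ := isCompact_univ.elim_nhds_subcover K fun x _ => hKn x
  have hKm (x : N) : MeasurableSet (K x) := (hKc x).isClosed.measurableSet
  set ν : Measure N := ∑ i ∈ t, (chartVolume I g.inner i).restrict (K i) with hν
  have hle : riemVolume I g.inner ≤ ν := by
    refine iSup_le fun x => Measure.le_iff.2 fun S hS => ?_
    have hSx : MeasurableSet (S ∩ (extChartAt I x).source) :=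
      hS.inter (isOpen_extChartAt_source x).measurableSet
    rw [chartVolume_inter_source _ x hS]
    calc chartVolume I g.inner x (S ∩ (extChartAt I x).source)
        ≤ chartVolume I g.inner x (⋃ i ∈ t, (S ∩ (extChartAt I x).source) ∩ K i) := by
          refine measure_mono fun z hz => ?_
          obtain ⟨i, hi, hzi⟩ := mem_iUnion₂.1 (ht (mem_univ z))
          exact mem_iUnion₂.2 ⟨i, hi, hz, hzi⟩
      _ ≤ ∑ i ∈ t, chartVolume I g.inner x ((S ∩ (extChartAt I x).source) ∩ K i) :=
          measure_biUnion_finset_le _ _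
      _ ≤ ∑ i ∈ t, (chartVolume I g.inner i).restrict (K i) S := by
          refine Finset.sum_le_sum fun i _ => ?_
          rw [chartVolume_eq_of_subset _ (hSx.inter (hKm i)) (fun z hz => hz.1.2)
            (fun z hz => hKs i hz.2), Measure.restrict_apply hS]
          exact measure_mono fun z hz => ⟨hz.1.1, hz.2⟩
      _ = ν S := by simp [hν]
  refine ⟨(hle univ).trans_lt ?_⟩
  simp only [hν, Measure.coe_finsetSum, Finset.sum_apply, Measure.restrict_apply_univ]
  exact ENNReal.sum_lt_top.2 fun i _ => chartVolume_lt_top g (hKc i) (hKm i) (hKs i)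

end Volume

/-! ### Real sequences approaching the ends of `(a, +∞)`. -/

section Exhaustion

lemma coe_toReal_of_mem_Ioo {a b c : EReal} (h : c ∈ Ioo a b) : (c.toReal : EReal) = c :=
  EReal.coe_toReal (ne_top_of_lt h.2) (ne_bot_of_gt h.1)

lemma tendsto_toward_iff {a r₀ : EReal} {u : ℕ → ℝ} (hu : ∀ n, u n ∈ radii a)
    (h : Tendsto (fun n => (u n : EReal)) atTop (𝓝 r₀)) : Tendsto u atTop (toward a r₀) :=
  tendsto_comap_iff.2 (tendsto_nhdsWithin_iff.2 ⟨h, Eventually.of_forall hu⟩)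

lemma exists_seq_increasing {a b : EReal} (hab : a < b) : ∃ u : ℕ → ℝ, StrictMono u ∧
    (∀ n, a < u n ∧ (u n : EReal) < b) ∧ Tendsto (fun n => (u n : EReal)) atTop (𝓝 b) := by
  obtain ⟨U, hU, hUm, hUt⟩ := exists_seq_strictMono_tendsto' hab
  have hc (n : ℕ) := coe_toReal_of_mem_Ioo (hUm n)
  refine ⟨fun n => (U n).toReal, fun m n hmn => ?_, fun n => ?_, ?_⟩
  · rw [← EReal.coe_lt_coe_iff, hc, hc]; exact hU hmn
  · rw [hc]; exact hUm n
  · simpa only [hc] using hUt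

lemma exists_seq_decreasing {a b : EReal} (hab : a < b) : ∃ u : ℕ → ℝ, StrictAnti u ∧
    (∀ n, a < u n ∧ (u n : EReal) < b) ∧ Tendsto (fun n => (u n : EReal)) atTop (𝓝 a) := by
  obtain ⟨U, hU, hUm, hUt⟩ := exists_seq_strictAnti_tendsto' hab
  have hc (n : ℕ) := coe_toReal_of_mem_Ioo (hUm n)
  refine ⟨fun n => (U n).toReal, fun m n hmn => ?_, fun n => ?_, ?_⟩
  · rw [← EReal.coe_lt_coe_iff, hc, hc]; exact hU hmn
  · rw [hc]; exact hUm n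
  · simpa only [hc] using hUt

/-- The filter is nontrivial at each `r₀ ∈ [a, +∞]`: `r₀` is approached from the right if `r₀ = a`,
and from the left otherwise. -/
lemma exists_mem_radii_of_eventually {a r₀ : EReal} (ha : a < ⊤) (hr : a ≤ r₀) {P : ℝ → Prop}
    (h : ∀ᶠ r in toward a r₀, P r) : ∃ r ∈ radii a, P r := by
  rcases hr.eq_or_lt with rfl | hlt
  · obtain ⟨u, -, hu, hut⟩ := exists_seq_decreasing ha
    obtain ⟨n, hn⟩ := ((tendsto_toward_iff (fun n => (hu n).1) hut).eventually h).exists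
    exact ⟨u n, (hu n).1, hn⟩
  · obtain ⟨u, -, hu, hut⟩ := exists_seq_increasing hlt
    obtain ⟨n, hn⟩ := ((tendsto_toward_iff (fun n => (hu n).1) hut).eventually h).exists
    exact ⟨u n, (hu n).1, hn⟩

lemma ordConnected_radii (a : EReal) : (radii a).OrdConnected :=
  ordConnected_Ioi.preimage_mono EReal.coe_strictMono.monotone

end Exhaustion

/-! ### Integration of the evolution of the mass. -/

section Monotonicity

variable {N : Type*} [TopologicalSpace N] [CompactSpace N] [SecondCountableTopology N]
  [MeasurableSpace N] [BorelSpace N] {μ : Measure N} [IsFiniteMeasure μ]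

lemma integrableOn_strip {R : Set ℝ} {f : ℝ × N → ℝ} (hf : ContinuousOn f (R ×ˢ univ)) {u v : ℝ}
    (huv : Icc u v ⊆ R) : IntegrableOn f (Ioc u v ×ˢ univ) ((volume : Measure ℝ).prod μ) := by
  have hc : IsCompact (Icc u v ×ˢ (univ : Set N)) := isCompact_Icc.prod isCompact_univ
  have hm : MeasurableSet (Icc u v ×ˢ (univ : Set N)) := measurableSet_Icc.prod .univ
  refine IntegrableOn.mono_set ?_ (prod_mono Ioc_subset_Icc_self Subset.rfl)
  exact (hf.mono (prod_mono huv Subset.rfl)).integrableOn_compact' hc hm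

/-- The fundamental theorem of calculus, integrated over a compact parameter space. -/
lemma integral_sub_eq_setIntegral {R : Set ℝ} {m m' : ℝ × N → ℝ}
    (hm : ContinuousOn m (R ×ˢ univ)) (hm' : ContinuousOn m' (R ×ˢ univ))
    (hd : ∀ r ∈ R, ∀ x, HasDerivAt (fun s => m (s, x)) (m' (r, x)) r) {u v : ℝ} (huv : u ≤ v)
    (hR : Icc u v ⊆ R) :
    (∫ x, m (v, x) ∂μ) - (∫ x, m (u, x) ∂μ) =
      ∫ p in Ioc u v ×ˢ univ, m' p ∂((volume : Measure ℝ).prod μ) := by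
  have hi (r : ℝ) (hr : r ∈ R) : Integrable (fun x => m (r, x)) μ := by
    have hc : Continuous fun x => m (r, x) := by
      rw [← continuousOn_univ]
      exact hm.comp (by fun_prop) fun x _ => ⟨hr, mem_univ _⟩
    rw [← integrableOn_univ]
    exact hc.continuousOn.integrableOn_compact' isCompact_univ .univ
  have hI := integrableOn_strip (μ := μ) hm' hR
  rw [IntegrableOn, ← Measure.prod_restrict, Measure.restrict_univ] at hI
  rw [← Measure.prod_restrict, Measure.restrict_univ, integral_prod_symm _ hI,
    ← integral_sub (hi v (hR ⟨huv, le_rfl⟩)) (hi u (hR ⟨le_rfl, huv⟩))]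
  refine integral_congr_ae (Eventually.of_forall fun x => ?_)
  have hc : ContinuousOn (fun s => m' (s, x)) (uIcc u v) := by
    rw [uIcc_of_le huv]
    exact hm'.comp (by fun_prop) fun s hs => ⟨hR hs, mem_univ _⟩
  have := intervalIntegral.integral_eq_sub_of_hasDerivAt (f := fun s => m (s, x))
    (f' := fun s => m' (s, x)) (a := u) (b := v)
    (fun s hs => hd s (hR (by rwa [uIcc_of_le huv] at hs)) x) hc.intervalIntegrable
  simp only
  rw [← this, intervalIntegral.integral_of_le huv]

/-- If the radial derivative of `m` exceeds an integrable function `f` by `q ≥ 0`, the increment of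
`∫ m` over `(a, ∞)` exceeds the integral of `f`, with equality if and only if `q = 0`. -/
lemma mass_increment [μ.IsOpenPosMeasure] {a : EReal} (ha : a < ⊤) {m f q : ℝ × N → ℝ}
    (hm : ContinuousOn m (radii a ×ˢ univ)) (hf : ContinuousOn f (radii a ×ˢ univ))
    (hq : ContinuousOn q (radii a ×ˢ univ))
    (hd : ∀ r ∈ radii a, ∀ x, HasDerivAt (fun s => m (s, x)) (f (r, x) + q (r, x)) r)
    (hq0 : ∀ r ∈ radii a, ∀ x, 0 ≤ q (r, x)) {M : ℝ → ℝ}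
    (hM : ∀ r ∈ radii a, M r = ∫ x, m (r, x) ∂μ) {Ma Mb : ℝ}
    (hMa : Tendsto M (toward a a) (𝓝 Ma)) (hMb : Tendsto M (toward a ⊤) (𝓝 Mb))
    (hint : IntegrableOn f (radii a ×ˢ univ) ((volume : Measure ℝ).prod μ)) :
    (∫ p in radii a ×ˢ univ, f p ∂((volume : Measure ℝ).prod μ)) ≤ Mb - Ma ∧
    (Mb - Ma = (∫ p in radii a ×ˢ univ, f p ∂((volume : Measure ℝ).prod μ)) ↔
      ∀ r ∈ radii a, ∀ x, q (r, x) = 0) := by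
  -- A level `c` separating the two sequences, which ensures `u n < c < v n`.
  obtain ⟨c, hac, -⟩ := EReal.lt_iff_exists_real_btwn.1 ha
  obtain ⟨u, hu, hum, hut⟩ := exists_seq_decreasing hac
  obtain ⟨v, hv, hvm, hvt⟩ := exists_seq_increasing (EReal.coe_lt_top c)
  have huR (n : ℕ) : u n ∈ radii a := (hum n).1
  have hvR (n : ℕ) : v n ∈ radii a := hac.trans (hvm n).1
  have huv (n : ℕ) : u n < v n := EReal.coe_lt_coe_iff.1 ((hum n).2.trans (hvm n).1)
  have hsub (n : ℕ) : Icc (u n) (v n) ⊆ radii a := (ordConnected_radii a).out (huR n) (hvR n)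
  set S : ℕ → Set (ℝ × N) := fun n => Ioc (u n) (v n) ×ˢ univ with hS
  have hSm (n : ℕ) : MeasurableSet (S n) := measurableSet_Ioc.prod .univ
  have hSmono : Monotone S := fun i j hij =>
    prod_mono (Ioc_subset_Ioc (hu.antitone hij) (hv.monotone hij)) Subset.rfl
  have hex (r : ℝ) (hr : r ∈ radii a) : ∃ n, r ∈ Ioo (u n) (v n) := by
    have h1 := hut.eventually_lt_const hr
    have h2 := hvt.eventually_const_lt (EReal.coe_lt_top r)
    obtain ⟨n, h3, h4⟩ := (h1.and h2).exists
    exact ⟨n, EReal.coe_lt_coe_iff.1 h3, EReal.coe_lt_coe_iff.1 h4⟩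
  have hSU : ⋃ n, S n = radii a ×ˢ univ := by
    ext ⟨r, x⟩
    simp only [hS, mem_iUnion, mem_prod, mem_univ, and_true]
    constructor
    · rintro ⟨n, hn⟩; exact hsub n (Ioc_subset_Icc_self hn)
    · intro hr
      obtain ⟨n, hn⟩ := hex r hr
      exact ⟨n, Ioo_subset_Ioc_self hn⟩
  set ρ := (volume : Measure ℝ).prod μ
  have hfS (n : ℕ) : IntegrableOn f (S n) ρ := integrableOn_strip hf (hsub n)
  have hqS (n : ℕ) : IntegrableOn q (S n) ρ := integrableOn_strip hq (hsub n)
  have hqS0 (n : ℕ) : 0 ≤ᵐ[ρ.restrict (S n)] q :=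
    (ae_restrict_iff' (hSm n)).2 (Eventually.of_forall fun p hp =>
      hq0 p.1 (hsub n (Ioc_subset_Icc_self hp.1)) p.2)
  have hF : Tendsto (fun n => ∫ p in S n, f p ∂ρ) atTop
      (𝓝 (∫ p in radii a ×ˢ univ, f p ∂ρ)) := by
    rw [← hSU]
    exact tendsto_setIntegral_of_monotone hSm hSmono (by rwa [hSU])
  -- Integrability of `q` on the whole of `(a, ∞) × N` is not assumed; its integrals over the strips
  -- are controlled through those of `f` and the increments of `M`.
  have hQeq (n : ℕ) : ∫ p in S n, q p ∂ρ = M (v n) - M (u n) - ∫ p in S n, f p ∂ρ := by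
    rw [hM _ (huR n), hM _ (hvR n), integral_sub_eq_setIntegral (m' := fun p => f p + q p) hm
      (hf.add hq) hd (huv n).le (hsub n), integral_add (hfS n) (hqS n)]
    ring
  set L := Mb - Ma - ∫ p in radii a ×ˢ univ, f p ∂ρ with hL
  have hQ : Tendsto (fun n => ∫ p in S n, q p ∂ρ) atTop (𝓝 L) := by
    simp only [hQeq]
    exact ((hMb.comp (tendsto_toward_iff hvR hvt)).sub
      (hMa.comp (tendsto_toward_iff huR hut))).sub hF
  have hQ0 (n : ℕ) : 0 ≤ ∫ p in S n, q p ∂ρ := integral_nonneg_of_ae (hqS0 n)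
  have hQmono : Monotone fun n => ∫ p in S n, q p ∂ρ := fun i j hij =>
    setIntegral_mono_set (hqS j) (hqS0 j) (hSmono hij).eventuallyLE
  have hL0 : 0 ≤ L := ge_of_tendsto' hQ hQ0
  refine ⟨by linarith, fun h => ?_, fun h => ?_⟩
  · intro r hr x
    obtain ⟨n, hn⟩ := hex r hr
    -- The integrals of `q ≥ 0` increase to `L = 0`, so each of them vanishes.
    have hz : ∫ p in S n, q p ∂ρ = 0 :=
      le_antisymm ((hQmono.ge_of_tendsto hQ n).trans_eq (by rw [hL, h, sub_self])) (hQ0 n)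
    have hae := (setIntegral_eq_zero_iff_of_nonneg_ae (hqS0 n) (hqS n)).1 hz
    -- Passing from almost everywhere to everywhere uses an open set, whereas `S n` is half-open.
    have hsubO : Ioo (u n) (v n) ×ˢ (univ : Set N) ⊆ S n :=
      prod_mono Ioo_subset_Ioc_self Subset.rfl
    have hae' : q =ᵐ[ρ.restrict (Ioo (u n) (v n) ×ˢ univ)] fun _ => 0 :=
      ae_restrict_of_ae_restrict_of_subset hsubO hae
    exact Measure.eqOn_open_of_ae_eq hae' (isOpen_Ioo.prod isOpen_univ)
      (hq.mono (prod_mono (Ioo_subset_Icc_self.trans (hsub n)) Subset.rfl)) continuousOn_const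
      (mk_mem_prod hn (mem_univ x))
  · have hz (n : ℕ) : ∫ p in S n, q p ∂ρ = 0 := by
      rw [setIntegral_congr_fun (g := fun _ => (0 : ℝ)) (hSm n) fun p hp =>
        h p.1 (hsub n (Ioc_subset_Icc_self hp.1)) p.2]
      simp
    simp only [hz] at hQ
    have := tendsto_nhds_unique tendsto_const_nhds hQ
    linarith

end Monotonicity

/-! ### The warping function. -/

section Warp

/-- The derivative of the warping function. -/
noncomputable def warpDeriv (k r : ℝ) : ℝ := Real.exp r - k * Real.exp (-r)

lemma hasDerivAt_exp_neg' (r : ℝ) : HasDerivAt (fun s : ℝ => Real.exp (-s)) (-Real.exp (-r)) r := by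
  simpa using (hasDerivAt_neg r).exp

lemma hasDerivAt_warp (k r : ℝ) : HasDerivAt (warp k) (warpDeriv k r) r := by
  have := (Real.hasDerivAt_exp r).add ((hasDerivAt_exp_neg' r).const_mul k)
  refine this.congr_deriv ?_
  rw [warpDeriv]; ring

lemma hasDerivAt_warpDeriv (k r : ℝ) : HasDerivAt (warpDeriv k) (warp k r) r := by
  have := (Real.hasDerivAt_exp r).sub ((hasDerivAt_exp_neg' r).const_mul k)
  refine this.congr_deriv ?_
  rw [warp]; ring

lemma contDiff_warp (k : ℝ) : ContDiff ℝ ∞ (warp k) :=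
  Real.contDiff_exp.add (contDiff_const.mul (Real.contDiff_exp.comp contDiff_neg))

lemma continuous_warpDeriv (k : ℝ) : Continuous (warpDeriv k) := by
  unfold warpDeriv; fun_prop

/-- A zero `s` satisfies `e^{2s} = -k`, so there is at most one, and it is the excluded endpoint
`a`. -/
lemma warp_ne_zero {k : ℝ} {a : EReal}
    (ha : (∃ r₀ : ℝ, warp k r₀ = 0 ∧ a = (r₀ : EReal)) ∨ ((∀ r : ℝ, warp k r ≠ 0) ∧ a = ⊥))
    {r : ℝ} (hr : r ∈ radii a) : warp k r ≠ 0 := by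
  rcases ha with ⟨r₀, h0, rfl⟩ | ⟨h, -⟩
  · intro h
    have hlt : r₀ < r := EReal.coe_lt_coe_iff.1 hr
    have key (s : ℝ) (hs : warp k s = 0) : Real.exp (2 * s) = -k := by
      have h1 : Real.exp s * warp k s = Real.exp (2 * s) + k := by
        rw [warp, mul_add, ← Real.exp_add, mul_left_comm, ← Real.exp_add]
        simp [two_mul]
      rw [hs, mul_zero] at h1
      linarith
    have := Real.exp_injective ((key r h).trans (key r₀ h0).symm)
    linarith
  · exact h r

lemma lt_top_of_warp {k : ℝ} {a : EReal}
    (ha : (∃ r₀ : ℝ, warp k r₀ = 0 ∧ a = (r₀ : EReal)) ∨ ((∀ r : ℝ, warp k r ≠ 0) ∧ a = ⊥)) :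
    a < ⊤ := by
  rcases ha with ⟨r₀, -, rfl⟩ | ⟨-, rfl⟩
  · exact EReal.coe_lt_top r₀
  · exact bot_lt_top

end Warp

/-! ### Warped products, the excess, and the evolution of the local mass. -/

section WarpedProducts

variable {d : ℕ} {H : Type*} [TopologicalSpace H]
  {I : ModelWithCorners ℝ (EuclideanSpace ℝ (Fin d)) H}
  {N : Type*} [TopologicalSpace N] [ChartedSpace H N]

local notation "𝔼" => EuclideanSpace ℝ (Fin d)

set_option synthInstance.maxHeartbeats 400000 in
/-- A positive multiple of a Riemannian metric. -/
noncomputable def scaleMetric [IsManifold I ∞ N] (c : ℝ) (hc : 0 < c) (g : SmoothMetric I (N := N)) :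
    SmoothMetric I (N := N) where
  inner x := c • g.inner x
  symm x v w := by
    change c * g.inner x v w = c * g.inner x w v
    rw [g.symm x v w]
  pos x v hv := mul_pos hc (g.pos x v hv)
  isVonNBounded x := by
    -- The unit ball of `c g` is the unit ball of `g` scaled by `1 / √c`.
    have h := (g.isVonNBounded x).image
      ((Real.sqrt c)⁻¹ • ContinuousLinearMap.id ℝ (TangentSpace I x))
    refine h.subset ?_
    intro v hv
    refine ⟨Real.sqrt c • v, ?_, ?_⟩
    · have hv' : c * g.inner x v v < 1 := hv
      have e : g.inner x (Real.sqrt c • v) (Real.sqrt c • v) = c * g.inner x v v := by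
        rw [map_smul, map_smul]
        change Real.sqrt c * (Real.sqrt c * g.inner x v v) = _
        rw [← mul_assoc, Real.mul_self_sqrt hc.le]
      simpa only [mem_ofPred_eq, e] using hv'
    · change (Real.sqrt c)⁻¹ • (Real.sqrt c • v) = v
      rw [smul_smul, inv_mul_cancel₀ (Real.sqrt_pos.2 hc).ne', one_smul]
  contMDiff := g.contMDiff.const_smul_section

variable {R : Set ℝ} {b : ℝ → BilinField I N} {g : BilinField I N} {h h₁ h₂ : ℝ → ℝ}

lemma IsMetricFamily.gramDeriv_of_warped (hb : IsMetricFamily R b)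
    (hbg : ∀ s ∈ R, b s = warpFamily I h g s) (hh : ∀ s, HasDerivAt h (h₁ s) s) {r : ℝ} (hr : r ∈ R)
    {x : N} {y : 𝔼} (hy : y ∈ (extChartAt I x).target) :
    gramDeriv I b x (r, y) = (2 * h r * h₁ r) • gram I g x y := by
  ext A B
  refine (hb.hasDerivAt_gram hr hy A B).unique ?_
  have h1 : HasDerivAt (fun s => h s ^ 2 * gram I g x y A B)
      (2 * h r * h₁ r * gram I g x y A B) r := by
    simpa using ((hh r).pow 2).mul_const (gram I g x y A B)
  refine h1.congr_of_eventuallyEq ?_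
  filter_upwards [hb.isOpen.mem_nhds hr] with s hs
  rw [hbg s hs, gram_warpFamily]
  rfl

lemma IsMetricFamily.gramDeriv₂_of_warped (hb : IsMetricFamily R b)
    (hbg : ∀ s ∈ R, b s = warpFamily I h g s) (hh : ∀ s, HasDerivAt h (h₁ s) s)
    (hh₁ : ∀ s, HasDerivAt h₁ (h₂ s) s) {r : ℝ} (hr : r ∈ R)
    {x : N} {y : 𝔼} (hy : y ∈ (extChartAt I x).target) :
    gramDeriv₂ I b x (r, y) = (2 * (h₁ r ^ 2 + h r * h₂ r)) • gram I g x y := by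
  ext A B
  refine (hb.hasDerivAt_gramDeriv hr hy A B).unique ?_
  have h1 : HasDerivAt (fun s => 2 * h s * h₁ s * gram I g x y A B)
      (2 * (h₁ r ^ 2 + h r * h₂ r) * gram I g x y A B) r := by
    refine ((((hh r).const_mul 2).mul (hh₁ r)).mul_const (gram I g x y A B)).congr_deriv ?_
    ring
  refine h1.congr_of_eventuallyEq ?_
  filter_upwards [hb.isOpen.mem_nhds hr] with s hs
  rw [hb.gramDeriv_of_warped hbg hh hs hy]
  rfl

/-- A warped product asymptotic to the background is the background. -/
lemma eq_of_asymptoticAt {a r₀ : EReal} (ha : a < ⊤) (har : a ≤ r₀) (h0 : ∀ s ∈ radii a, h s ≠ 0)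
    {b : ℝ → BilinField I N} {g' : BilinField I N}
    (hbg : ∀ s ∈ radii a, b s = warpFamily I h g' s)
    (has : AsymptoticAt I a h g b r₀) : g' = g := by
  funext x
  ext v w
  -- Both sides of the asymptotic estimate carry a factor `h²`. Once it is cancelled `r` disappears,
  -- so one value of `r` for each `ε` is enough.
  have key (ε : ℝ) (hε : 0 < ε) :
      |g' x v w - g x v w| ≤ ε * (Real.sqrt (g x v v) * Real.sqrt (g x w w)) := by
    obtain ⟨r, hr, h1⟩ := exists_mem_radii_of_eventually ha har (has ε hε)
    have h2 := h1 x v w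
    have hr2 : 0 < h r ^ 2 := by have := h0 r hr; positivity
    rw [hbg r hr] at h2
    simp only [warpFamily_apply, Real.sqrt_mul hr2.le] at h2
    rw [← mul_sub, abs_mul, abs_of_pos hr2] at h2
    have h3 := Real.mul_self_sqrt hr2.le
    refine le_of_mul_le_mul_left (h2.trans_eq ?_) hr2
    linear_combination (ε * (Real.sqrt (g x v v) * Real.sqrt (g x w w))) * h3
  have hlim : Tendsto (fun ε : ℝ => ε * (Real.sqrt (g x v v) * Real.sqrt (g x w w))) (𝓝[>] 0)
      (𝓝 0) := by
    have : Continuous fun ε : ℝ => ε * (Real.sqrt (g x v v) * Real.sqrt (g x w w)) := by fun_prop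
    simpa using this.continuousWithinAt (s := Ioi 0) (x := 0) |>.tendsto
  have h4 := ge_of_tendsto hlim (eventually_nhdsWithin_of_forall key)
  exact sub_eq_zero.1 (abs_nonpos_iff.1 h4)

variable [IsManifold I ∞ N]

lemma IsMetricFamily.logDeriv_of_eq_smul (hb : IsMetricFamily R b) {r : ℝ} (hr : r ∈ R) {x : N}
    {y : 𝔼} (hy : y ∈ (extChartAt I x).target) {c : ℝ} {M : Matrix (Fin d) (Fin d) ℝ}
    (hM : M = c • gram I (b r) x y) : (gram I (b r) x y)⁻¹ * M = c • 1 := by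
  rw [hM, Matrix.mul_smul,
    Matrix.nonsing_inv_mul _ ((Matrix.isUnit_iff_isUnit_det _).1 (hb.posDef hr hy).isUnit)]

lemma meanCurv_warpFamily (hb : IsMetricFamily R (warpFamily I h g))
    (hh : ∀ s, HasDerivAt h (h₁ s) s) (h0 : ∀ s ∈ R, h s ≠ 0) {r : ℝ} (hr : r ∈ R) (x : N) :
    meanCurv I (warpFamily I h g) r x = d * (h₁ r / h r) := by
  have hy := mem_extChartAt_target (I := I) x
  have hl : logDeriv I (warpFamily I h g) x (r, extChartAt I x x) = (2 * (h₁ r / h r)) • 1 := by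
    refine hb.logDeriv_of_eq_smul hr hy ?_
    rw [hb.gramDeriv_of_warped (fun _ _ => rfl) hh hr hy, gram_warpFamily, smul_smul]
    congr 1
    have := h0 r hr
    field_simp
  rw [hb.meanCurv_eq hr, hl, Matrix.trace_smul, Matrix.trace_one, Fintype.card_fin, smul_eq_mul]
  ring

lemma ricciRR_warpFamily (hb : IsMetricFamily R (warpFamily I h g))
    (hh : ∀ s, HasDerivAt h (h₁ s) s) (hh₁ : ∀ s, HasDerivAt h₁ (h₂ s) s)
    (h0 : ∀ s ∈ R, h s ≠ 0) {r : ℝ} (hr : r ∈ R) (x : N) :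
    ricciRR I (warpFamily I h g) r x = -(d * (h₂ r / h r)) := by
  have hy := mem_extChartAt_target (I := I) x
  have hr0 := h0 r hr
  have hl : logDeriv I (warpFamily I h g) x (r, extChartAt I x x) = (2 * (h₁ r / h r)) • 1 := by
    refine hb.logDeriv_of_eq_smul hr hy ?_
    rw [hb.gramDeriv_of_warped (fun _ _ => rfl) hh hr hy, gram_warpFamily, smul_smul]
    congr 1
    field_simp
  have hl₂ : logDeriv₂ I (warpFamily I h g) x (r, extChartAt I x x) =
      (2 * (h₁ r ^ 2 + h r * h₂ r) / h r ^ 2) • 1 := by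
    refine hb.logDeriv_of_eq_smul hr hy ?_
    rw [hb.gramDeriv₂_of_warped (fun _ _ => rfl) hh hh₁ hr hy, gram_warpFamily, smul_smul]
    congr 1
    field_simp
  rw [hb.ricciRR_eq hr, hl, hl₂]
  simp only [Matrix.smul_mul, Matrix.mul_smul, Matrix.one_mul, Matrix.trace_smul, Matrix.trace_one,
    Fintype.card_fin, smul_eq_mul]
  field_simp
  ring

/-- The excess `h² tr ((S - h'/h)²)` of the radial derivative of the local mass. -/
noncomputable def excess (I : ModelWithCorners ℝ (EuclideanSpace ℝ (Fin d)) H) (h h₁ : ℝ → ℝ)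
    (b : ℝ → BilinField I N) (p : ℝ × N) : ℝ :=
  d * h₁ p.1 ^ 2 - 2 * h₁ p.1 * (h p.1 / 2) * traceDeriv I b p +
    (h p.1 / 2) ^ 2 * traceDerivSq I b p

lemma IsMetricFamily.gramDeriv_isSymm (hb : IsMetricFamily R b) {r : ℝ} (hr : r ∈ R) {x : N}
    {y : 𝔼} (hy : y ∈ (extChartAt I x).target) : (gramDeriv I b x (r, y)).IsSymm := by
  refine Matrix.IsSymm.ext fun A B => ?_
  refine (hb.hasDerivAt_gram hr hy B A).unique
    ((hb.hasDerivAt_gram hr hy A B).congr_of_eventuallyEq ?_)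
  filter_upwards [hb.isOpen.mem_nhds hr] with s hs
  exact (Matrix.isHermitian_iff_isSymm.1 (hb.posDef hs hy).isHermitian).apply A B

/-- This is `trace_sq_smul_one_sub` with `A = G`, `B = ∂_r G`, `c = h'` and `s = h/2`, for which `c
- s A⁻¹ B = h' - h S`. -/
lemma IsMetricFamily.excess_nonneg (hb : IsMetricFamily R b) {r : ℝ} (hr : r ∈ R)
    (h0 : h r ≠ 0) (x : N) : 0 ≤ excess I h h₁ b (r, x) ∧ (excess I h h₁ b (r, x) = 0 ↔
      gramDeriv I b x (r, extChartAt I x x) =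
        (2 * (h₁ r / h r)) • gram I (b r) x (extChartAt I x x)) := by
  have hy := mem_extChartAt_target (I := I) x
  have key := trace_sq_smul_one_sub (hb.posDef hr hy) (hb.gramDeriv_isSymm hr hy) (h₁ r) (h r / 2)
    (by simpa using h0)
  rw [Fintype.card_fin, show h₁ r / (h r / 2) = 2 * (h₁ r / h r) by field_simp] at key
  exact key

/-- The metric is a warped product as soon as the excess vanishes. -/
lemma IsMetricFamily.eq_smul_of_excess_eq_zero (hb : IsMetricFamily R b) (hR : IsPreconnected R)
    (hh : ∀ s, HasDerivAt h (h₁ s) s) (h0 : ∀ s ∈ R, h s ≠ 0)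
    (hq : ∀ r ∈ R, ∀ x, excess I h h₁ b (r, x) = 0) {r r₁ : ℝ} (hr : r ∈ R) (hr₁ : r₁ ∈ R) (x : N) :
    b r x = h r ^ 2 • ((h r₁ ^ 2)⁻¹ • b r₁ x) := by
  have hy := mem_extChartAt_target (I := I) x
  have hg (A B : Fin d) : gram I (b r) x (extChartAt I x x) A B =
      h r ^ 2 * ((h r₁ ^ 2)⁻¹ * gram I (b r₁) x (extChartAt I x x) A B) := by
    -- Vanishing excess means `∂_r G = 2 (h'/h) G`, which says exactly that `G / h²` has zero radial
    -- derivative.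
    have hd (s : ℝ) (hs : s ∈ R) :
        HasDerivAt (fun s => gram I (b s) x (extChartAt I x x) A B / h s ^ 2) 0 s := by
      have h1 := (hb.hasDerivAt_gram hs hy A B).div ((hh s).pow 2) (pow_ne_zero 2 (h0 s hs))
      refine h1.congr_deriv ?_
      have hs0 := h0 s hs
      rw [(hb.excess_nonneg hs hs0 x).2.1 (hq s hs x), Matrix.smul_apply, smul_eq_mul]
      simp only [Pi.pow_apply]
      field_simp
      push_cast
      ring
    have hc : gram I (b r) x (extChartAt I x x) A B / h r ^ 2 =
        gram I (b r₁) x (extChartAt I x x) A B / h r₁ ^ 2 := hb.isOpen.is_const_of_deriv_eq_zero hR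
      (fun s hs => (hd s hs).differentiableAt.differentiableWithinAt)
      (fun s hs => (hd s hs).deriv) hr hr₁
    have h1 := h0 r hr
    have h2 := h0 r₁ hr₁
    rw [div_eq_iff (pow_ne_zero 2 h1)] at hc
    rw [hc]
    ring
  ext v w
  change b r x v w = h r ^ 2 * ((h r₁ ^ 2)⁻¹ * b r₁ x v w)
  rw [bilin_eq_sum_gram (b r) x v w, bilin_eq_sum_gram (b r₁) x v w]
  simp only [hg, Finset.mul_sum]
  refine Finset.sum_congr rfl fun A _ => Finset.sum_congr rfl fun B _ => ?_
  ring

lemma IsMetricFamily.excess_eq_zero_of_warped (hb : IsMetricFamily R b)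
    (hbg : ∀ s ∈ R, b s = warpFamily I h g s) (hh : ∀ s, HasDerivAt h (h₁ s) s)
    (h0 : ∀ s ∈ R, h s ≠ 0) {r : ℝ} (hr : r ∈ R) (x : N) : excess I h h₁ b (r, x) = 0 := by
  have hr0 := h0 r hr
  rw [(hb.excess_nonneg hr hr0 x).2,
    hb.gramDeriv_of_warped hbg hh hr (mem_extChartAt_target x), hbg r hr, gram_warpFamily,
    smul_smul]
  congr 1
  field_simp

/-- The evolution of the local mass, for a warping function with `h'' = h`. -/
lemma IsMetricFamily.hasDerivAt_localMass (hb : IsMetricFamily R b)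
    (hb₀ : IsMetricFamily R (warpFamily I h g)) (hh : ∀ s, HasDerivAt h (h₁ s) s)
    (hh₁ : ∀ s, HasDerivAt h₁ (h s) s) (h0 : ∀ s ∈ R, h s ≠ 0) {r : ℝ} (hr : r ∈ R) (x : N) :
    HasDerivAt (fun s => localMass I h g b s x)
      (h r ^ 2 * (ricciRR I b r x + d) + excess I h h₁ b (r, x)) r := by
  -- The local mass with the division by `h` cleared: `d h h' - h² H`. By `h'' = h` its first term
  -- has derivative `d h'² + d h²`; the `d h²` joins the Ricci term, the `d h'²` completes the
  -- square in the excess.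
  have h1 : HasDerivAt (fun s => d * (h s * h₁ s) - 1 / 2 * (h s ^ 2 * traceDeriv I b (s, x)))
      (h r ^ 2 * (ricciRR I b r x + d) + excess I h h₁ b (r, x)) r := by
    have h2 := (((hh r).mul (hh₁ r)).const_mul (d : ℝ)).sub
      ((((hh r).pow 2).mul (hb.hasDerivAt_traceDeriv hr x)).const_mul (1 / 2))
    refine h2.congr_deriv ?_
    rw [hb.ricciRR_eq hr, excess]
    simp only [traceDeriv, traceDeriv₂, traceDerivSq, Pi.pow_apply]
    push_cast
    ring
  refine h1.congr_of_eventuallyEq ?_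
  filter_upwards [hb.isOpen.mem_nhds hr] with s hs
  have hs0 := h0 s hs
  rw [localMass, meanCurv_warpFamily hb₀ hh h0 hs, hb.meanCurv_eq hs, traceDeriv]
  field_simp

end WarpedProducts

/-! ### Continuity of the integrands. -/

section Continuity

variable {d : ℕ} {H : Type*} [TopologicalSpace H]
  {I : ModelWithCorners ℝ (EuclideanSpace ℝ (Fin d)) H}
  {N : Type*} [TopologicalSpace N] [ChartedSpace H N] [IsManifold I ∞ N]
  {R : Set ℝ} {b : ℝ → BilinField I N} {g : BilinField I N} {h h₁ : ℝ → ℝ}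

lemma IsMetricFamily.continuousOn_excess (hb : IsMetricFamily R b) (hh : Continuous h)
    (hh₁ : Continuous h₁) : ContinuousOn (excess I h h₁ b) (R ×ˢ univ) := by
  have e1 := hb.continuousOn_traceDeriv
  have e2 := hb.continuousOn_traceDerivSq
  unfold excess
  fun_prop

lemma IsMetricFamily.continuousOn_ricciRR (hb : IsMetricFamily R b) :
    ContinuousOn (fun p : ℝ × N => ricciRR I b p.1 p.2) (R ×ˢ univ) := by
  have e1 := hb.continuousOn_traceDeriv₂
  have e2 := hb.continuousOn_traceDerivSq
  have : ContinuousOn (fun p => -(1 / 2) * traceDeriv₂ I b p + 1 / 4 * traceDerivSq I b p)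
    (R ×ˢ univ) := by fun_prop
  exact this.congr fun p hp => hb.ricciRR_eq hp.1 p.2

lemma IsMetricFamily.continuousOn_localMass (hb : IsMetricFamily R b)
    (hb₀ : IsMetricFamily R (warpFamily I h g)) (hh : ∀ s, HasDerivAt h (h₁ s) s)
    (hh₁ : Continuous h₁) (h0 : ∀ s ∈ R, h s ≠ 0) :
    ContinuousOn (fun p : ℝ × N => localMass I h g b p.1 p.2) (R ×ˢ univ) := by
  have e1 := hb.continuousOn_traceDeriv
  have hc : Continuous h := continuous_iff_continuousAt.2 fun s => (hh s).continuousAt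
  have : ContinuousOn (fun p : ℝ × N => d * (h p.1 * h₁ p.1) -
    1 / 2 * (h p.1 ^ 2 * traceDeriv I b p)) (R ×ˢ univ) := by fun_prop
  refine this.congr fun p hp => ?_
  have hs0 := h0 p.1 hp.1
  simp only [localMass, meanCurv_warpFamily hb₀ hh h0 hp.1, hb.meanCurv_eq hp.1, traceDeriv]
  field_simp

end Continuity

end RadialMass

/-! ### The main theorem. -/

theorem corollary5p1 (n : ℕ) (hn : 2 ≤ n)
    {H : Type*} [TopologicalSpace H]
    (I : ModelWithCorners ℝ (EuclideanSpace ℝ (Fin (n - 1))) H)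
    {N : Type*} [TopologicalSpace N] [ChartedSpace H N] [IsManifold I ∞ N]
    [T2Space N] [CompactSpace N] [MeasurableSpace N] [BorelSpace N]
    (k : ℝ) (a : EReal)
    (ha : (∃ r₀ : ℝ, RadialMass.warp k r₀ = 0 ∧ a = (r₀ : EReal)) ∨
      ((∀ r : ℝ, RadialMass.warp k r ≠ 0) ∧ a = ⊥))
    (Ghat : RadialMass.SmoothMetric I (N := N))
    (G : ℝ → RadialMass.SmoothMetric I (N := N))
    (hG : RadialMass.SmoothFamily I a G)
    (Ma Mb : ℝ)
    (hMa : Tendsto (RadialMass.mass I (RadialMass.warp k) Ghat.inner (fun r => (G r).inner))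
      (RadialMass.toward a a) (𝓝 Ma))
    (hMb : Tendsto (RadialMass.mass I (RadialMass.warp k) Ghat.inner (fun r => (G r).inner))
      (RadialMass.toward a ⊤) (𝓝 Mb))
    (hint : IntegrableOn
      (fun p : ℝ × N => RadialMass.warp k p.1 ^ 2 *
        (RadialMass.ricciRR I (fun r => (G r).inner) p.1 p.2 + ((n : ℝ) - 1)))
      (RadialMass.radii a ×ˢ univ)
      ((volume : Measure ℝ).prod (RadialMass.riemVolume I Ghat.inner))) :
    (∀ r ∈ RadialMass.radii a, ∀ x : N,
      RadialMass.ricciRR I (RadialMass.warpFamily I (RadialMass.warp k) Ghat.inner) r x =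
        -((n : ℝ) - 1)) ∧
    (∫ p in RadialMass.radii a ×ˢ (univ : Set N), RadialMass.warp k p.1 ^ 2 *
        (RadialMass.ricciRR I (fun r => (G r).inner) p.1 p.2 + ((n : ℝ) - 1))
        ∂((volume : Measure ℝ).prod (RadialMass.riemVolume I Ghat.inner))) ≤ Mb - Ma ∧
    (Mb - Ma = (∫ p in RadialMass.radii a ×ˢ (univ : Set N), RadialMass.warp k p.1 ^ 2 *
        (RadialMass.ricciRR I (fun r => (G r).inner) p.1 p.2 + ((n : ℝ) - 1))
        ∂((volume : Measure ℝ).prod (RadialMass.riemVolume I Ghat.inner))) ↔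
      ∃ Gtilde : RadialMass.SmoothMetric I (N := N), ∀ r ∈ RadialMass.radii a, ∀ x : N,
        (G r).inner x = RadialMass.warp k r ^ 2 • Gtilde.inner x) ∧
    ∀ r₀ : EReal, a ≤ r₀ →
      RadialMass.AsymptoticAt I a (RadialMass.warp k) Ghat.inner (fun r => (G r).inner) r₀ →
      (Mb - Ma = (∫ p in RadialMass.radii a ×ˢ (univ : Set N), RadialMass.warp k p.1 ^ 2 *
          (RadialMass.ricciRR I (fun r => (G r).inner) p.1 p.2 + ((n : ℝ) - 1))
          ∂((volume : Measure ℝ).prod (RadialMass.riemVolume I Ghat.inner))) ↔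
        ∀ r ∈ RadialMass.radii a, ∀ x : N,
          (G r).inner x = RadialMass.warp k r ^ 2 • Ghat.inner x) := by
  have : SecondCountableTopology H := I.secondCountableTopology
  have : SecondCountableTopology N := ChartedSpace.secondCountable_of_sigmaCompact H N
  have hn1 : (n : ℝ) - 1 = ((n - 1 : ℕ) : ℝ) := by
    rw [Nat.cast_sub (by omega), Nat.cast_one]
  simp only [hn1] at hint ⊢
  have h0 : ∀ r ∈ RadialMass.radii a, RadialMass.warp k r ≠ 0 := fun r hr =>
    RadialMass.warp_ne_zero ha hr
  have hatop := RadialMass.lt_top_of_warp ha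
  have hh := RadialMass.hasDerivAt_warp k
  have hh₁ := RadialMass.hasDerivAt_warpDeriv k
  have hhc := (RadialMass.contDiff_warp k).continuous
  have hb := RadialMass.isMetricFamily_of_smoothFamily hG
  have hb₀ := RadialMass.isMetricFamily_warp (RadialMass.isOpen_radii a) Ghat
    (RadialMass.contDiff_warp k) h0
  have hmain := RadialMass.mass_increment hatop
    (hb.continuousOn_localMass hb₀ hh (RadialMass.continuous_warpDeriv k) h0)
    (f := fun p : ℝ × N => RadialMass.warp k p.1 ^ 2 *
      (RadialMass.ricciRR I (fun r => (G r).inner) p.1 p.2 + ((n - 1 : ℕ) : ℝ)))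
    (((hhc.comp continuous_fst).pow 2).continuousOn.mul
      (hb.continuousOn_ricciRR.add continuousOn_const))
    (hb.continuousOn_excess hhc (RadialMass.continuous_warpDeriv k))
    (fun r hr x => hb.hasDerivAt_localMass hb₀ hh hh₁ h0 hr x)
    (fun r hr x => (hb.excess_nonneg hr (h0 r hr) x).1) (fun r _ => rfl) hMa hMb hint
  have hwarped : (∀ r ∈ RadialMass.radii a, ∀ x : N, RadialMass.excess I (RadialMass.warp k)
      (RadialMass.warpDeriv k) (fun r => (G r).inner) (r, x) = 0) ↔
      ∃ Gtilde : RadialMass.SmoothMetric I (N := N), ∀ r ∈ RadialMass.radii a, ∀ x : N,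
        (G r).inner x = RadialMass.warp k r ^ 2 • Gtilde.inner x := by
    constructor
    · intro hq
      -- Any reference level serves: the metric sought on `N` is `h(r₁)⁻² G(r₁)`.
      obtain ⟨r₁, hr₁, -⟩ := EReal.lt_iff_exists_real_btwn.1 hatop
      have hc : 0 < (RadialMass.warp k r₁ ^ 2)⁻¹ := by have := h0 r₁ hr₁; positivity
      exact ⟨RadialMass.scaleMetric _ hc (G r₁), fun r hr x => hb.eq_smul_of_excess_eq_zero
        (RadialMass.ordConnected_radii a).isPreconnected hh h0 hq hr hr₁ x⟩
    · rintro ⟨Gt, hGt⟩ r hr x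
      exact hb.excess_eq_zero_of_warped (g := Gt.inner) (fun s hs => funext (hGt s hs)) hh h0 hr x
  refine ⟨fun r hr x => ?_, hmain.1, hmain.2.trans hwarped, fun r₀ har has => ?_⟩
  · rw [RadialMass.ricciRR_warpFamily hb₀ hh hh₁ h0 hr x, div_self (h0 r hr), mul_one]
  · refine (hmain.2.trans hwarped).trans ⟨?_, fun h => ⟨Ghat, h⟩⟩
    rintro ⟨Gt, hGt⟩
    have := RadialMass.eq_of_asymptoticAt hatop har h0 (g' := Gt.inner)
      (fun s hs => funext (hGt s hs)) has
    rw [← this]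
    exact hGt
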